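/- Let $X$ be a connected finite graph (a connected finite CW complex of dimension at most $1$), and let $f:X\to X$ be a continuous selfmap that is $\pi_1$-injective, i.e. $f_*:\pi_1(X,x)\to\pi_1(X,f(x))$ is injective for every $x\in X$. Let $p:\tilde X\to X$ be a universal covering with group $\pi$ of covering transformations (a free group of finite rank), and let $\tilde f:\tilde X\to\tilde X$ be any lifting of $f$, i.e. $p\circ\tilde f=f\circ p$. Let $\mathbf F=p(\mathrm{Fix}\,\tilde f)$ be the fixed point class of $f$ labelled by $\tilde f$, and let $\tilde f_\pi:\pi\to\pi$ be the endomorphism determined by $\tilde f\circ\gamma=\tilde f_\pi(\gamma)\circ\tilde f$ for $\gamma\in\pi$. Put $\mathrm{rk}(\mathbf F)=\mathrm{rk}\,\mathrm{Fix}(\tilde f_\pi)$, the minimal number of generators of $\mathrm{Fix}(\tilde f_\pi)=\{\gamma\in\pi:\tilde f_\pi(\gamma)=\gamma\}$. Fix a basis of $\pi$. An infinite reduced word $W=w_1w_2\cdots$ with initial segments $W_i=w_1\cdots w_i$ is an attracting fixed word of $\tilde f_\pi$ if $\tilde f_\pi(W_i)\to W$, i.e. $|W\wedge \tilde f_\pi(W_i)|\to\infty$,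 and moreover $|W\wedge \tilde f_\pi(W_i)|-i\to+\infty$ as $i\to\infty$, where $|W\wedge V|$ is the length of the longest common initial segment of $W$ and the reduced word $V$. Two attracting fixed words $W,W'$ are equivalent if $W'=UW$ for some $U\in\mathrm{Fix}(\tilde f_\pi)$. Let $a(\mathbf F)$ be the number of equivalence classes of attracting fixed words of $\tilde f_\pi$, and let $\mathrm{ichr}(\mathbf F)=1-\mathrm{rk}(\mathbf F)-a(\mathbf F)$. If $\mathbf F$ is empty, then $0\le \mathrm{ichr}(\mathbf F)\le 1$. Equivalently, if $\mathrm{rk}(\mathbf F)+a(\mathbf F)>1$, then $\tilde f$ has a fixed point. -/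

import Mathlib

open Set Filter Topology

namespace GraphFix

universe u v

/-! ### Local path-connectedness of CW complexes and of their coverings -/

theorem locallyPathConnectedSpace_of_cw (X : Type u) [TopologicalSpace X] [T2Space X]
    [CWComplex (univ : Set X)] : LocallyPathConnectedSpace X := by
  let B : (Σ n, RelCWComplex.cell (univ : Set X) n) → Type :=
    fun s => Metric.closedBall (0 : Fin s.1 → ℝ) 1
  let q : (Σ s, B s) → X := fun z => RelCWComplex.map z.1.1 z.1.2 z.2.1
  have : ∀ s, LocallyPathConnectedSpace (B s) := fun s =>
    (convex_closedBall (0 : Fin s.1 → ℝ) 1).locallyPathConnectedSpace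
  have hcont : ∀ s : (Σ n, RelCWComplex.cell (univ : Set X) n),
      Continuous fun x : B s => RelCWComplex.map s.1 s.2 x.1 := fun s =>
    continuousOn_iff_continuous_domRestrict.1 (RelCWComplex.continuousOn s.1 s.2)
  have hq : Continuous q := continuous_sigma hcont
  have hsurj : Function.Surjective q := by
    intro x
    have hx : x ∈ ⋃ (n : ℕ) (j : RelCWComplex.cell (univ : Set X) n),
        RelCWComplex.map n j '' Metric.closedBall 0 1 := by
      have := CWComplex.union' (C := (univ : Set X))
      exact this.symm ▸ mem_univ x
    simp only [mem_iUnion] at hx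
    obtain ⟨n, j, y, hy, rfl⟩ := hx
    exact ⟨⟨⟨n, j⟩, ⟨y, hy⟩⟩, rfl⟩
  have hquot : IsQuotientMap q := by
    refine isQuotientMap_iff_isClosed.2 ⟨hsurj, fun A => ⟨fun h => h.preimage hq, fun h => ?_⟩⟩
    refine CWComplex.closed' (C := (univ : Set X)) A (subset_univ A) fun n j => ?_
    let s : (Σ n, RelCWComplex.cell (univ : Set X) n) := ⟨n, j⟩
    have h1 : IsClosed ((fun x : B s => RelCWComplex.map s.1 s.2 x.1) ⁻¹' A) :=
      (isClosed_sigma_iff.1 h) s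
    have : CompactSpace (B s) := isCompact_iff_compactSpace.1 (isCompact_closedBall _ _)
    have h2 := (h1.isCompact.image (hcont s)).isClosed
    convert h2 using 1
    ext x
    constructor
    · rintro ⟨hxA, y, hy, rfl⟩
      exact ⟨⟨y, hy⟩, hxA, rfl⟩
    · rintro ⟨⟨y, hy⟩, hyA, rfl⟩
      exact ⟨hyA, y, hy, rfl⟩
  exact hquot.locallyPathConnectedSpace

theorem locallyPathConnectedSpace_of_covering {X : Type u} [TopologicalSpace X]
    [LocallyPathConnectedSpace X] {E : Type v} [TopologicalSpace E] {p : E → X}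
    (hp : IsCoveringMap p) : LocallyPathConnectedSpace E := by
  choose e he hpe using hp.isLocalHomeomorph
  let _ : ChartedSpace X E :=
    { atlas := range e
      chartAt := e
      mem_chart_source := he
      chart_mem_atlas := fun x => mem_range_self x }
  exact ChartedSpace.locallyPathConnectedSpace X E

/-! ### Covering transformations, liftings and the induced endomorphism -/

section Covering

variable {X : Type u} [TopologicalSpace X] {E : Type v} [TopologicalSpace E]

/-- The group of covering transformations (deck transformations) of `p : E → X`; the product is
composition. -/
def deckGroup (p : C(E, X)) : Subgroup (E ≃ₜ E) where
  carrier := {γ | ∀ x, p (γ x) = p x}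
  mul_mem' := fun {a b} ha hb x => (ha (b x)).trans (hb x)
  one_mem' := fun _ => rfl
  inv_mem' := fun {a} ha x => by
    have h := ha (a.symm x)
    rw [a.apply_symm_apply] at h
    exact h.symm

/-- A lifting of `f : X → X` to the covering `p : E → X`: a map `F : E → E` with `p ∘ F = f ∘ p`. -/
structure Lifting (p : C(E, X)) (f : C(X, X)) where
  toMap : C(E, E)
  map_proj : ∀ x, p (toMap x) = f (p x)

/-- A universal covering: a covering map whose total space is simply connected. -/
structure IsUniversalCovering (p : C(E, X)) : Prop where
  isCoveringMap : IsCoveringMap p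
  simplyConnected : SimplyConnectedSpace E

variable {p : C(E, X)} {f : C(X, X)}

/-- The fixed point class of `f` labelled by (the conjugacy class of) the lifting `F`. -/
def Lifting.fixedPointClass (F : Lifting p f) : Set X :=
  p '' {x | F.toMap x = x}

theorem Lifting.existsUnique_deck [LocallyPathConnectedSpace X] (hp : IsUniversalCovering p)
    (F : Lifting p f) (γ : deckGroup p) :
    ∃! δ : deckGroup p, ∀ x, F.toMap (γ.1 x) = δ.1 (F.toMap x) := by
  have := hp.simplyConnected
  have := locallyPathConnectedSpace_of_covering hp.isCoveringMap
  obtain ⟨x₀⟩ : Nonempty E := inferInstance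
  have cov := hp.isCoveringMap
  have hpp : p (F.toMap (γ.1 x₀)) = p (F.toMap x₀) := by
    rw [F.map_proj, F.map_proj, γ.2 x₀]
  have huniq : ∀ g h : C(E, E), (∀ x, p (g x) = p (h x)) → ∀ a, g a = h a → g = h := by
    intro g h hgh a ha
    refine (cov.existsUnique_continuousMap_lifts (p.comp g) a (g a) rfl).unique
      ⟨rfl, rfl⟩ ⟨ha.symm, ?_⟩
    funext x
    exact (hgh x).symm
  obtain ⟨g, ⟨hg0, hgp⟩, -⟩ :=
    cov.existsUnique_continuousMap_lifts p (F.toMap x₀) (F.toMap (γ.1 x₀)) hpp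
  obtain ⟨h, ⟨hh0, hhp⟩, -⟩ :=
    cov.existsUnique_continuousMap_lifts p (F.toMap (γ.1 x₀)) (F.toMap x₀) hpp.symm
  have hgp' : ∀ x, p (g x) = p x := fun x => congrFun hgp x
  have hhp' : ∀ x, p (h x) = p x := fun x => congrFun hhp x
  have hhg : h.comp g = ContinuousMap.id E :=
    huniq _ _ (fun x => by simp [hgp', hhp']) (F.toMap x₀) (by simp [hg0, hh0])
  have hgh : g.comp h = ContinuousMap.id E :=
    huniq _ _ (fun x => by simp [hgp', hhp']) (F.toMap (γ.1 x₀)) (by simp [hg0, hh0])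
  let δ : E ≃ₜ E :=
    { toFun := g
      invFun := h
      left_inv := fun x => DFunLike.congr_fun hhg x
      right_inv := fun x => DFunLike.congr_fun hgh x
      continuous_toFun := g.continuous
      continuous_invFun := h.continuous }
  refine ⟨⟨δ, hgp'⟩, ?_, ?_⟩
  · have := huniq (F.toMap.comp ⟨γ.1, γ.1.continuous⟩) (g.comp F.toMap)
      (fun x => by simp [hgp', F.map_proj, γ.2 x]) x₀ (by simp [hg0])
    exact fun x => DFunLike.congr_fun this x
  · intro δ' hδ'
    have := huniq ⟨δ'.1, δ'.1.continuous⟩ g (fun x => by simpa [hgp'] using δ'.2 x)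
      (F.toMap x₀) (by simpa [hg0] using (hδ' x₀).symm)
    apply Subtype.ext
    ext x
    exact DFunLike.congr_fun this x

/-- The endomorphism `φ` of the group of covering transformations induced by a lifting `F`,
determined by `F ∘ γ = φ(γ) ∘ F`. -/
noncomputable def Lifting.inducedHom [LocallyPathConnectedSpace X] (hp : IsUniversalCovering p)
    (F : Lifting p f) : deckGroup p →* deckGroup p where
  toFun γ := (F.existsUnique_deck hp γ).choose
  map_one' := ((F.existsUnique_deck hp 1).choose_spec.2 1 fun _ => rfl).symm
  map_mul' a b := by
    refine ((F.existsUnique_deck hp (a * b)).choose_spec.2 _ fun x => ?_).symm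
    have h1 := (F.existsUnique_deck hp a).choose_spec.1 (b.1 x)
    have h2 := (F.existsUnique_deck hp b).choose_spec.1 x
    exact h1.trans (congrArg _ h2)

theorem Lifting.inducedHom_spec [LocallyPathConnectedSpace X] (hp : IsUniversalCovering p)
    (F : Lifting p f) (γ : deckGroup p) (x : E) :
    F.toMap (γ.1 x) = (F.inducedHom hp γ).1 (F.toMap x) :=
  (F.existsUnique_deck hp γ).choose_spec.1 x

end Covering

/-! ### Infinite words and attracting fixed words -/

section Words

variable {ι : Type*}

/-- Infinite reduced words in the letters `ι^{±1}`: the boundary of the free group on `ι`.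
The letter `(i, true)` is the generator `i` and `(i, false)` its inverse. -/
structure InfWord (ι : Type*) where
  letter : ℕ → ι × Bool
  reduced : ∀ i, (letter i).1 = (letter (i + 1)).1 → (letter i).2 = (letter (i + 1)).2

/-- The initial segment of length `k`, as a list of letters. -/
def InfWord.initial (W : InfWord ι) (k : ℕ) : List (ι × Bool) :=
  List.ofFn fun j : Fin k => W.letter j

variable [DecidableEq ι]

/-- The length `|W ∧ V|` of the longest common initial segment of the infinite word `W` and of the
reduced word of `V`. -/
def InfWord.meetLength (W : InfWord ι) (V : FreeGroup ι) : ℕ :=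
  Nat.findGreatest (fun k => V.toWord.take k = W.initial k) V.toWord.length

/-- A sequence of elements of the free group converges to the infinite word `W`. -/
def InfWord.IsLimit (W : InfWord ι) (V : ℕ → FreeGroup ι) : Prop :=
  Tendsto (fun i => W.meetLength (V i)) atTop atTop

/-- `W` is a fixed infinite word of (the continuous extension to the boundary of) `φ`: the words
`φ(W_i)` converge to `W`, where `W_i` is the initial segment of `W` of length `i`. -/
def InfWord.IsFixed (φ : FreeGroup ι →* FreeGroup ι) (W : InfWord ι) : Prop :=
  W.IsLimit fun i => φ (FreeGroup.mk (W.initial i))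

/-- `W` is an attracting fixed word of `φ`: it is fixed and `|W ∧ φ(W_i)| - i → +∞`. -/
def InfWord.IsAttracting (φ : FreeGroup ι →* FreeGroup ι) (W : InfWord ι) : Prop :=
  W.IsFixed φ ∧
    Tendsto (fun i : ℕ => (W.meetLength (φ (FreeGroup.mk (W.initial i))) : ℤ) - (i : ℤ))
      atTop atTop

/-- `W' = U W`, for the action of the free group on its boundary extending left
multiplication: the elements `U W_i` converge to `W'`. -/
def InfWord.IsTranslate (U : FreeGroup ι) (W W' : InfWord ι) : Prop :=
  W'.IsLimit fun i => U * FreeGroup.mk (W.initial i)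

/-- `W` and `W'` are equivalent: `W' = U W` for some fixed element `U` of `φ`. -/
def InfWord.Equivalent (φ : FreeGroup ι →* FreeGroup ι) (W W' : InfWord ι) : Prop :=
  ∃ U : FreeGroup ι, φ U = U ∧ InfWord.IsTranslate U W W'

/-- The set of equivalence classes of attracting fixed words of `φ`. -/
def attractingClasses (φ : FreeGroup ι →* FreeGroup ι) : Set (Set (InfWord ι)) :=
  {C | ∃ W : InfWord ι, W.IsAttracting φ ∧
    C = {W' | W'.IsAttracting φ ∧ InfWord.Equivalent φ W W'}}

end Words

/-! ### Rank, the number of attracting classes and the improved characteristic -/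

/-- The rank of a group: the minimal number of generators. -/
noncomputable def groupRank (G : Type*) [Group G] : ℕ∞ :=
  ⨅ S : {S : Set G // Subgroup.closure S = ⊤}, S.1.encard

/-- The fixed subgroup of an endomorphism. -/
def fixSubgroup {G : Type*} [Group G] (φ : G →* G) : Subgroup G where
  carrier := {g | φ g = g}
  mul_mem' := fun {a b} (ha : φ a = a) (hb : φ b = b) => by
    change φ (a * b) = a * b
    rw [map_mul, ha, hb]
  one_mem' := map_one φ
  inv_mem' := fun {a} (ha : φ a = a) => by
    change φ a⁻¹ = a⁻¹
    rw [map_inv, ha]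

open scoped Classical in
/-- The number `a(φ)` of equivalence classes of attracting fixed words of an endomorphism `φ` of a
free group `G` of finite rank, computed in words with respect to a fixed basis of `G`.
(The value `0` is assigned by convention when `G` is not free of finite rank.) -/
noncomputable def attractingNumber {G : Type*} [Group G] (φ : G →* G) : ℕ∞ :=
  if h : ∃ n : ℕ, Nonempty (FreeGroupBasis (Fin n) G) then
    let b : FreeGroupBasis (Fin h.choose) G := h.choose_spec.some
    (attractingClasses
      ((b.repr.toMonoidHom.comp φ).comp b.repr.symm.toMonoidHom)).encard
  else 0

section Characteristic

variable {X : Type u} [TopologicalSpace X] {E : Type v} [TopologicalSpace E]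
  {p : C(E, X)} {f : C(X, X)} [LocallyPathConnectedSpace X]

/-- The rank of the stabilizer (the fixed subgroup of the induced endomorphism) of the fixed point
class labelled by `F`. -/
noncomputable def Lifting.rk (hp : IsUniversalCovering p) (F : Lifting p f) : ℕ∞ :=
  groupRank (fixSubgroup (F.inducedHom hp))

/-- The number of equivalence classes of attracting fixed words of the fixed point class labelled
by `F`. -/
noncomputable def Lifting.a (hp : IsUniversalCovering p) (F : Lifting p f) : ℕ∞ :=
  attractingNumber (F.inducedHom hp)

/-- The improved characteristic `1 - rk - a`. It takes values in the extended reals, so that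
an infinite rank or an infinite number of classes would give the value `-∞`. -/
noncomputable def Lifting.ichr (hp : IsUniversalCovering p) (F : Lifting p f) : EReal :=
  1 - (((F.rk hp : ℕ∞) : ENNReal) : EReal) - (((F.a hp : ℕ∞) : ENNReal) : EReal)

end Characteristic

/-- `f` is `π₁`-injective: it induces injective homomorphisms of fundamental groups. -/
def IsPiOneInjective {X : Type u} [TopologicalSpace X] (f : C(X, X)) : Prop :=
  ∀ x : X, Function.Injective (FundamentalGroup.map f x)

instance instLocallyPathConnectedSpaceOfCW (X : Type u) [TopologicalSpace X] [T2Space X]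
    [CWComplex (univ : Set X)] : LocallyPathConnectedSpace X :=
  locallyPathConnectedSpace_of_cw X

end GraphFix

/-! The total space `E` is a tree. Each edge `σ` has a height function: the retraction of the tree
onto `σ`, read in the parameter of `σ`. If `F` has no fixed point, the height of `F (σ t)` never
equals `t` inside `σ`, so `F` pushes all interior points of `σ` the same way and thereby orients
`σ`. At each vertex `y` exactly one edge points outwards, the one leading towards `F y`. Following
it defines a selfmap `s` of the vertex set: it has no periodic points, any two of its orbits merge,
and it commutes with the covering transformations fixed by the induced endomorphism `φ`
(`exists_isFlow`).

The fixed subgroup of `φ` acts freely on the vertices and commutes with `s`, so the translation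
number along a flow line embeds it in the integers, and its rank is at most 1
(`isCyclic_of_acyclic`). If `W` is attracting, every flow line converges to `W`: vertices near `W_i`
are sent near `φ(W_i)`, much farther along `W`, so a flow line that has entered from there cannot
come back out (`eventually_prefix`). Hence there is at most one attracting word. If moreover some `g
≠ 1` is fixed, a flow line is periodic up to `g` or its inverse, and each long `W_i` is within
bounded distance of a power of that element. The displacement `w⁻¹ * φ w` does not change when `w`
is multiplied on the left by a fixed element, so it stays bounded along `W`, contrary to attraction
(`not_isAttracting_of_translation`). Therefore rank and number of classes add up to at most 1. -/

namespace GraphFix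

/-! ### Edge systems -/

section EdgeSystem

variable {E : Type v} [TopologicalSpace E]

/-- The reversed path. -/
def revEdge (σ : C(unitInterval, E)) : C(unitInterval, E) :=
  σ.comp ⟨unitInterval.symm, unitInterval.continuous_symm⟩

@[simp] theorem revEdge_apply (σ : C(unitInterval, E)) (t : unitInterval) :
    revEdge σ t = σ (unitInterval.symm t) := rfl

@[simp] theorem revEdge_revEdge (σ : C(unitInterval, E)) : revEdge (revEdge σ) = σ := by
  ext t; simp

theorem revEdge_eq_iff {σ τ : C(unitInterval, E)} : revEdge σ = τ ↔ σ = revEdge τ :=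
  ⟨fun h => by simp [← h], fun h => by simp [h]⟩

/-- The interior of the unit interval. -/
def openInterval : Set unitInterval := Ioo 0 1

theorem symm_mem_openInterval {t : unitInterval} :
    unitInterval.symm t ∈ openInterval ↔ t ∈ openInterval := by
  simp only [openInterval, mem_Ioo, ← Subtype.coe_lt_coe, unitInterval.coe_symm_eq,
    Set.Icc.coe_zero, Set.Icc.coe_one]
  constructor <;> rintro ⟨h1, h2⟩ <;> constructor <;> linarith

theorem eq_zero_or_one_of_notMem {t : unitInterval} (h : t ∉ openInterval) : t = 0 ∨ t = 1 := by
  by_contra! hc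
  exact h ⟨lt_of_le_of_ne unitInterval.nonneg' hc.1.symm, lt_of_le_of_ne unitInterval.le_one' hc.2⟩

/-- A set of oriented edges in a one-dimensional complex, closed under reversal, with disjoint
injective interiors and such that the space carries the weak topology. -/
structure IsEdgeSystem (𝓔 : Set C(unitInterval, E)) : Prop where
  rev_mem : ∀ σ ∈ 𝓔, revEdge σ ∈ 𝓔
  inj : ∀ σ ∈ 𝓔, ∀ s t, s ∈ openInterval → σ s = σ t → s = t
  eq_or_eq_rev : ∀ σ ∈ 𝓔, ∀ τ ∈ 𝓔, ∀ s t, s ∈ openInterval → σ s = τ t → τ = σ ∨ τ = revEdge σ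
  isClosed_of_preimage : ∀ A : Set E, (∀ σ ∈ 𝓔, IsClosed (σ ⁻¹' A)) → IsClosed A

/-- The vertices of an edge system: the points outside all open edges. -/
def vertexSet (𝓔 : Set C(unitInterval, E)) : Set E :=
  {x | ∀ σ ∈ 𝓔, ∀ t ∈ openInterval, σ t ≠ x}

/-- A height function of an edge `σ`: it is the parameter on `σ` and constant on the other edges. -/
structure IsHeight (𝓔 : Set C(unitInterval, E)) (σ : C(unitInterval, E)) (h : E → ℝ) : Prop where
  continuous : Continuous h
  apply_edge : ∀ t : unitInterval, h (σ t) = t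
  const : ∀ τ ∈ 𝓔, τ ≠ σ → τ ≠ revEdge σ → ∀ s t, h (τ s) = h (τ t)

namespace IsEdgeSystem

variable {𝓔 : Set C(unitInterval, E)} (h𝓔 : IsEdgeSystem 𝓔)
include h𝓔

theorem isOpen_of_preimage (A : Set E) (hA : ∀ σ ∈ 𝓔, IsOpen (σ ⁻¹' A)) : IsOpen A :=
  isClosed_compl_iff.1 <| h𝓔.isClosed_of_preimage _ fun σ hσ => by
    rw [preimage_compl]; exact (hA σ hσ).isClosed_compl

theorem continuous_of_edges {Y : Type*} [TopologicalSpace Y] {g : E → Y}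
    (hg : ∀ σ ∈ 𝓔, Continuous (g ∘ σ)) : Continuous g :=
  continuous_def.2 fun U hU => h𝓔.isOpen_of_preimage _ fun σ hσ => by
    rw [← preimage_comp]; exact hU.preimage (hg σ hσ)

/-- On every edge the preimage of `A` is empty or everything, so `A` is clopen in the weak topology.
This takes the place of induction along edge paths. -/
theorem eq_univ_of_edges [PreconnectedSpace E] {A : Set E} (hne : A.Nonempty)
    (hA : ∀ σ ∈ 𝓔, ∀ s t, σ s ∈ A → σ t ∈ A) : A = univ := by
  have key : ∀ σ ∈ 𝓔, σ ⁻¹' A = ∅ ∨ σ ⁻¹' A = univ := by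
    intro σ hσ
    rcases (σ ⁻¹' A).eq_empty_or_nonempty with h | ⟨s, hs⟩
    · exact Or.inl h
    · exact Or.inr (eq_univ_of_forall fun t => hA σ hσ s t hs)
  refine IsClopen.eq_univ ⟨h𝓔.isClosed_of_preimage _ fun σ hσ => ?_,
    h𝓔.isOpen_of_preimage _ fun σ hσ => ?_⟩ hne
  · rcases key σ hσ with h | h <;> simp [h]
  · rcases key σ hσ with h | h <;> simp [h]

theorem zero_mem_vertexSet {σ : C(unitInterval, E)} (hσ : σ ∈ 𝓔) : σ 0 ∈ vertexSet 𝓔 := by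
  intro τ hτ t ht he
  rcases h𝓔.eq_or_eq_rev τ hτ σ hσ t 0 ht he with h | h
  · subst h
    have := h𝓔.inj σ hσ t 0 ht he
    subst this
    exact lt_irrefl _ ht.1
  · subst h
    have : t = 1 := (h𝓔.inj τ hτ t _ ht he).trans unitInterval.symm_zero
    subst this
    exact lt_irrefl _ ht.2

theorem one_mem_vertexSet {σ : C(unitInterval, E)} (hσ : σ ∈ 𝓔) : σ 1 ∈ vertexSet 𝓔 := by
  have := h𝓔.zero_mem_vertexSet (h𝓔.rev_mem σ hσ)
  simpa using this

omit h𝓔 in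
theorem eq_zero_or_one_of_mem_vertexSet {σ : C(unitInterval, E)} (hσ : σ ∈ 𝓔) {t : unitInterval}
    (ht : σ t ∈ vertexSet 𝓔) : t = 0 ∨ t = 1 :=
  eq_zero_or_one_of_notMem fun h => ht σ hσ t h rfl

theorem isClosed_of_subset_vertexSet {A : Set E} (hA : A ⊆ vertexSet 𝓔) : IsClosed A := by
  refine h𝓔.isClosed_of_preimage _ fun σ hσ => ?_
  refine Set.Finite.isClosed ((Set.toFinite {0, 1}).subset fun t ht => ?_)
  exact eq_zero_or_one_of_mem_vertexSet hσ (hA ht)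

/-- Collapsing the complement of the open edge maps `E` to a circle. Simple connectedness lifts this
map to the real line, and the lift vanishing at `σ 0` is the height. This is how the tree property
enters. -/
theorem exists_isHeight [SimplyConnectedSpace E] [LocallyPathConnectedSpace E]
    {σ : C(unitInterval, E)} (hσ : σ ∈ 𝓔) : ∃ h, IsHeight 𝓔 σ h := by
  classical
  -- The value 0 off the open edge is also the class of both ends 0 and 1 of the parameter interval.
  let c : E → AddCircle (1 : ℝ) := fun x =>
    if hx : ∃ t ∈ openInterval, σ t = x then ((hx.choose : ℝ) : AddCircle (1 : ℝ)) else 0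
  have c_edge : ∀ t : unitInterval, c (σ t) = ((t : ℝ) : AddCircle (1 : ℝ)) := by
    intro t
    by_cases ht : t ∈ openInterval
    · have hx : ∃ s ∈ openInterval, σ s = σ t := ⟨t, ht, rfl⟩
      have : hx.choose = t := h𝓔.inj σ hσ _ _ hx.choose_spec.1 hx.choose_spec.2
      simp only [c, dif_pos hx, this]
    · have hx : ¬ ∃ s ∈ openInterval, σ s = σ t := by
        rintro ⟨s, hs, he⟩
        exact ht (h𝓔.inj σ hσ _ _ hs he ▸ hs)
      simp only [c, dif_neg hx]
      rcases eq_zero_or_one_of_notMem ht with rfl | rfl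
      · simp
      · simpa using (AddCircle.coe_period (1 : ℝ)).symm
  have c_const : ∀ τ ∈ 𝓔, τ ≠ σ → τ ≠ revEdge σ → ∀ t, c (τ t) = 0 := by
    intro τ hτ h1 h2 t
    have hx : ¬ ∃ s ∈ openInterval, σ s = τ t := by
      rintro ⟨s, hs, he⟩
      exact (h𝓔.eq_or_eq_rev σ hσ τ hτ s t hs he).elim h1 h2
    simp only [c, dif_neg hx]
  have c_cont : Continuous c := by
    refine h𝓔.continuous_of_edges fun τ hτ => ?_
    by_cases h1 : τ = σ
    · subst h1
      have : c ∘ τ = fun t : unitInterval => ((t : ℝ) : AddCircle (1 : ℝ)) := funext c_edge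
      rw [this]
      exact (AddCircle.continuous_mk' 1).comp continuous_subtype_val
    by_cases h2 : τ = revEdge σ
    · have : c ∘ τ = fun t : unitInterval =>
          ((unitInterval.symm t : ℝ) : AddCircle (1 : ℝ)) := by
        funext t; simp only [h2, Function.comp_apply, revEdge_apply, c_edge]
      rw [this]
      exact (AddCircle.continuous_mk' 1).comp
        (continuous_subtype_val.comp unitInterval.continuous_symm)
    · have : c ∘ τ = fun _ => 0 := funext (c_const τ hτ h1 h2)
      rw [this]
      exact continuous_const
  have cov : IsCoveringMap ((↑) : ℝ → AddCircle (1 : ℝ)) := AddCircle.isCoveringMap_coe 1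
  obtain ⟨h, ⟨h0, hh⟩, -⟩ := cov.existsUnique_continuousMap_lifts ⟨c, c_cont⟩ (σ 0) 0
    (by simpa using (c_edge 0).symm)
  have hh' : ∀ x, ((h x : ℝ) : AddCircle (1 : ℝ)) = c x := fun x => congrFun hh x
  refine ⟨h, h.continuous, fun t => ?_, fun τ hτ h1 h2 s t => ?_⟩
  · have := cov.eq_of_comp_eq (g₁ := h ∘ σ) (g₂ := fun t : unitInterval => (t : ℝ))
      (h.continuous.comp σ.continuous) continuous_subtype_val
      (funext fun t => by simp only [Function.comp_apply, hh', c_edge]) 0 (by simpa using h0)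
    exact congrFun this t
  · exact cov.const_of_comp (g := h ∘ τ) (h.continuous.comp τ.continuous)
      (fun a a' => by simp only [Function.comp_apply, hh', c_const τ hτ h1 h2]) s t

end IsEdgeSystem

/-! ### Heights and the two sides of an edge -/

namespace IsHeight

variable {𝓔 : Set C(unitInterval, E)} {σ : C(unitInterval, E)} {h h' : E → ℝ}

theorem apply_rev (hh : IsHeight 𝓔 σ h) (t : unitInterval) : h (revEdge σ t) = 1 - t := by
  rw [revEdge_apply, hh.apply_edge, unitInterval.coe_symm_eq]

theorem unique [PreconnectedSpace E] (h𝓔 : IsEdgeSystem 𝓔) (hh : IsHeight 𝓔 σ h)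
    (hh' : IsHeight 𝓔 σ h') : h = h' := by
  have : {x | h x = h' x} = univ := by
    refine h𝓔.eq_univ_of_edges ⟨σ 0, by simp [hh.apply_edge, hh'.apply_edge]⟩ ?_
    intro τ hτ s t hs
    by_cases h1 : τ = σ
    · subst h1; simp [hh.apply_edge, hh'.apply_edge]
    by_cases h2 : τ = revEdge σ
    · subst h2; simp [hh.apply_edge, hh'.apply_edge]
    · rw [mem_ofPred_eq] at hs ⊢
      rw [hh.const τ hτ h1 h2 t s, hh'.const τ hτ h1 h2 t s, hs]
  exact funext fun x => (this ▸ mem_univ x : x ∈ {x | h x = h' x})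

theorem rev (hh : IsHeight 𝓔 σ h) : IsHeight 𝓔 (revEdge σ) (fun x => 1 - h x) where
  continuous := continuous_const.sub hh.continuous
  apply_edge t := by
    rw [hh.apply_rev]; ring
  const τ hτ h1 h2 s t := by
    rw [revEdge_revEdge] at h2
    simp only [hh.const τ hτ h2 h1 s t]

/-- An edge other than `σ` and its reverse meets `σ` only at ends, so its constant height is 0 or 1
as soon as it touches `σ`; connectedness spreads this over `E`. -/
theorem edge_or [PreconnectedSpace E] (h𝓔 : IsEdgeSystem 𝓔) (hσ : σ ∈ 𝓔) (hh : IsHeight 𝓔 σ h)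
    (x : E) : h x = 0 ∨ h x = 1 ∨ ∃ t, σ t = x := by
  have : {x | h x = 0 ∨ h x = 1 ∨ ∃ t, σ t = x} = univ := by
    refine h𝓔.eq_univ_of_edges ⟨σ 0, Or.inr (Or.inr ⟨0, rfl⟩)⟩ ?_
    intro τ hτ s t hs
    by_cases h1 : τ = σ
    · subst h1; exact Or.inr (Or.inr ⟨t, rfl⟩)
    by_cases h2 : τ = revEdge σ
    · subst h2; exact Or.inr (Or.inr ⟨_, rfl⟩)
    · have hs' : h (τ s) = 0 ∨ h (τ s) = 1 := by
        rcases hs with hs | hs | ⟨r, hr⟩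
        · exact Or.inl hs
        · exact Or.inr hs
        · by_cases hr' : r ∈ openInterval
          · exact ((h𝓔.eq_or_eq_rev σ hσ τ hτ r s hr' hr).elim h1 h2).elim
          · rw [← hr, hh.apply_edge]
            rcases eq_zero_or_one_of_notMem hr' with rfl | rfl <;> simp
      rw [mem_ofPred_eq, hh.const τ hτ h1 h2 t s]
      tauto
  exact (this ▸ mem_univ x : x ∈ {x | h x = 0 ∨ h x = 1 ∨ ∃ t, σ t = x})

theorem nonneg [PreconnectedSpace E] (h𝓔 : IsEdgeSystem 𝓔) (hσ : σ ∈ 𝓔) (hh : IsHeight 𝓔 σ h)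
    (x : E) : 0 ≤ h x := by
  rcases hh.edge_or h𝓔 hσ x with h0 | h0 | ⟨t, rfl⟩
  · exact h0.ge
  · simp [h0]
  · rw [hh.apply_edge]; exact t.2.1

theorem eq_edge [PreconnectedSpace E] (h𝓔 : IsEdgeSystem 𝓔) (hσ : σ ∈ 𝓔) (hh : IsHeight 𝓔 σ h)
    {x : E} {t : unitInterval} (ht : t ∈ openInterval) (hx : h x = t) : x = σ t := by
  have h0 : (0 : ℝ) < t := ht.1
  have h1 : (t : ℝ) < 1 := ht.2
  rcases hh.edge_or h𝓔 hσ x with hx' | hx' | ⟨s, rfl⟩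
  · linarith
  · linarith
  · rw [hh.apply_edge] at hx
    rw [Subtype.ext hx]

/-- Removing the initial vertex from the set of height `0` leaves an open set. -/
theorem isOpen_zero_diff [PreconnectedSpace E] (h𝓔 : IsEdgeSystem 𝓔) (hσ : σ ∈ 𝓔)
    (hh : IsHeight 𝓔 σ h) : IsOpen ({x | h x = 0} \ {σ 0}) := by
  refine h𝓔.isOpen_of_preimage _ fun τ hτ => ?_
  have hcl : IsOpen (τ ⁻¹' {σ 0})ᶜ := by
    refine IsClosed.isOpen_compl (self := ((Set.toFinite {0, 1}).subset fun t ht => ?_).isClosed)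
    refine IsEdgeSystem.eq_zero_or_one_of_mem_vertexSet hτ ?_
    rw [show τ t = σ 0 from ht]
    exact h𝓔.zero_mem_vertexSet hσ
  by_cases h1 : τ = σ
  · subst h1
    convert isOpen_empty
    ext t
    simp only [mem_preimage, Set.mem_sdiff, mem_ofPred_eq, hh.apply_edge, mem_singleton_iff,
      mem_empty_iff_false, iff_false, not_and, not_not]
    intro ht
    rw [show t = 0 from Subtype.ext ht]
  by_cases h2 : τ = revEdge σ
  · subst h2
    convert isOpen_empty
    ext t
    simp only [mem_preimage, Set.mem_sdiff, mem_ofPred_eq, revEdge_apply, hh.apply_edge,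
      mem_singleton_iff, mem_empty_iff_false, iff_false, not_and, not_not]
    intro ht
    rw [show unitInterval.symm t = 0 from Subtype.ext ht]
  · by_cases h0 : h (τ 0) = 0
    · convert hcl
      ext t
      simp [hh.const τ hτ h1 h2 t 0, h0]
    · convert isOpen_empty
      ext t
      simp [hh.const τ hτ h1 h2 t 0, h0]

/-- A connected set avoiding the initial vertex and meeting the set of height `0` lies in it. -/
theorem subset_of_isPreconnected [PreconnectedSpace E] (h𝓔 : IsEdgeSystem 𝓔) (hσ : σ ∈ 𝓔)
    (hh : IsHeight 𝓔 σ h) {Q : Set E} (hQ : IsPreconnected Q) (hQσ : σ 0 ∉ Q) {x : E}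
    (hx : x ∈ Q) (hx0 : h x = 0) {y : E} (hy : y ∈ Q) : h y = 0 := by
  by_contra hne
  have hU := hh.isOpen_zero_diff h𝓔 hσ
  have hV : IsOpen {x | h x ≠ 0} := isOpen_ne_fun hh.continuous continuous_const
  obtain ⟨z, -, hz1, hz2⟩ := hQ _ _ hU hV
    (fun z hz => by
      by_cases h0 : h z = 0
      · exact Or.inl ⟨h0, fun he => hQσ (he ▸ hz)⟩
      · exact Or.inr h0)
    ⟨x, hx, hx0, fun he => hQσ (he ▸ hx)⟩ ⟨y, hy, hne⟩
  exact hz2 hz1.1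

end IsHeight

end EdgeSystem

/-! ### The direction field of a fixed point free selfmap of a tree -/

section Flow

variable {E : Type v} [TopologicalSpace E]

/-- An edge `σ` is forward for a selfmap `F` if `F` moves every interior point of `σ` in the
direction of `σ`. -/
def IsForward (𝓔 : Set C(unitInterval, E)) (F : C(E, E)) (σ : C(unitInterval, E)) : Prop :=
  ∃ h, IsHeight 𝓔 σ h ∧ ∀ t ∈ openInterval, (t : ℝ) < h (F (σ t))

theorem exists_mem_openInterval {U : Set unitInterval} (hU : IsOpen U) (h0 : (0 : unitInterval) ∈ U) :
    ∃ t ∈ openInterval, t ∈ U := by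
  have : (0 : unitInterval) ∈ closure openInterval := by
    rw [openInterval, closure_Ioo zero_ne_one]
    exact ⟨le_rfl, zero_le_one⟩
  obtain ⟨t, ht1, ht2⟩ := mem_closure_iff.1 this U hU h0
  exact ⟨t, ht2, ht1⟩

namespace IsEdgeSystem

variable [SimplyConnectedSpace E] {𝓔 : Set C(unitInterval, E)}
  (h𝓔 : IsEdgeSystem 𝓔) {F : C(E, E)} {σ τ : C(unitInterval, E)}
include h𝓔

/-- A height strictly between 0 and 1 determines the point, so an interior zero of `h (F (σ t)) - t`
would be a fixed point. By the intermediate value theorem the sign is constant. -/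
theorem isForward_or [LocallyPathConnectedSpace E] (hF : ∀ x, F x ≠ x) (hσ : σ ∈ 𝓔) :
    IsForward 𝓔 F σ ∨ IsForward 𝓔 F (revEdge σ) := by
  obtain ⟨h, hh⟩ := h𝓔.exists_isHeight hσ
  have hcont : Continuous fun t : unitInterval => h (F (σ t)) - t :=
    (hh.continuous.comp (F.continuous.comp σ.continuous)).sub continuous_subtype_val
  have hne : ∀ t ∈ openInterval, h (F (σ t)) - t ≠ 0 := fun t ht h0 =>
    hF _ (hh.eq_edge h𝓔 hσ ht (sub_eq_zero.1 h0))
  have hpre : IsPreconnected openInterval := isPreconnected_Ioo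
  by_cases hpos : ∀ t ∈ openInterval, 0 < h (F (σ t)) - t
  · exact Or.inl ⟨h, hh, fun t ht => sub_pos.1 (hpos t ht)⟩
  · right
    push Not at hpos
    obtain ⟨a, ha, ha0⟩ := hpos
    have hneg : ∀ t ∈ openInterval, h (F (σ t)) - t < 0 := by
      intro t ht
      by_contra! hc
      obtain ⟨r, hr, hr0⟩ := hpre.intermediate_value ha ht hcont.continuousOn ⟨ha0, hc⟩
      exact hne r hr hr0
    refine ⟨_, hh.rev, fun t ht => ?_⟩
    have := hneg _ (symm_mem_openInterval.2 ht)
    rw [unitInterval.coe_symm_eq] at this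
    rw [revEdge_apply]
    linarith

theorem not_isForward_rev (hσ : IsForward 𝓔 F σ) : ¬ IsForward 𝓔 F (revEdge σ) := by
  rintro ⟨h', hh', hf'⟩
  obtain ⟨h, hh, hf⟩ := hσ
  obtain rfl := hh'.unique h𝓔 hh.rev
  obtain ⟨t, ht, -⟩ := exists_mem_openInterval isOpen_univ (mem_univ _)
  have h1 := hf t ht
  have h2 := hf' _ (symm_mem_openInterval.2 ht)
  rw [revEdge_apply, unitInterval.symm_symm, unitInterval.coe_symm_eq] at h2
  linarith

/-- Were the height 0, `F (σ 0)` would lie in the open set of height 0 without `σ 0`, and so would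
`F (σ t)` for some interior `t`, against forwardness. -/
theorem pos_of_isForward (hF : ∀ x, F x ≠ x) (hσ : σ ∈ 𝓔) (hfw : IsForward 𝓔 F σ) {h : E → ℝ}
    (hh : IsHeight 𝓔 σ h) : 0 < h (F (σ 0)) := by
  obtain ⟨h', hh', hf⟩ := hfw
  obtain rfl := hh'.unique h𝓔 hh
  refine lt_of_le_of_ne (hh.nonneg h𝓔 hσ _) fun h0 => ?_
  obtain ⟨t, ht, htU⟩ := exists_mem_openInterval
    ((hh.isOpen_zero_diff h𝓔 hσ).preimage (F.continuous.comp σ.continuous)) ⟨h0.symm, hF _⟩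
  have h1 := hf t ht
  have h2 : h' (F (σ t)) = 0 := htU.1
  have h3 : (0 : ℝ) < t := ht.1
  linarith

theorem isForward_of_pos [LocallyPathConnectedSpace E] (hF : ∀ x, F x ≠ x) (hσ : σ ∈ 𝓔) {h : E → ℝ} (hh : IsHeight 𝓔 σ h)
    (hpos : 0 < h (F (σ 0))) : IsForward 𝓔 F σ := by
  refine (h𝓔.isForward_or hF hσ).resolve_right ?_
  rintro ⟨h', hh', hf⟩
  obtain rfl := hh'.unique h𝓔 hh.rev
  have hcont : Continuous fun t : unitInterval => h (F (σ t)) - t :=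
    (hh.continuous.comp (F.continuous.comp σ.continuous)).sub continuous_subtype_val
  obtain ⟨t, ht, htU⟩ := exists_mem_openInterval (isOpen_lt continuous_const hcont)
    (by simpa using hpos)
  have h1 := hf _ (symm_mem_openInterval.2 ht)
  rw [revEdge_apply, unitInterval.symm_symm, unitInterval.coe_symm_eq] at h1
  have h2 : 0 < h (F (σ t)) - t := htU
  linarith

/-- The forward edge is the one leading to `F u`. If there were none, the points other than `u` with
height 0 on all edges out of `u` would include `F u` and every edge they meet, hence all of `E`,
even `u`. -/
theorem exists_isForward [LocallyPathConnectedSpace E] (hF : ∀ x, F x ≠ x) {u : E} (hu : u ∈ vertexSet 𝓔) :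
    ∃ σ ∈ 𝓔, σ 0 = u ∧ IsForward 𝓔 F σ := by
  by_contra! hno
  choose! H hH using fun σ (hσ : σ ∈ 𝓔) => h𝓔.exists_isHeight hσ
  let A : Set E := {x | x ≠ u ∧ ∀ σ ∈ 𝓔, σ 0 = u → H σ x = 0}
  have hA : A = univ := by
    refine h𝓔.eq_univ_of_edges ⟨F u, hF u, fun σ hσ h0 => ?_⟩ ?_
    · by_contra hne
      refine hno σ hσ h0 (h𝓔.isForward_of_pos hF hσ (hH σ hσ) ?_)
      rw [h0]
      exact lt_of_le_of_ne ((hH σ hσ).nonneg h𝓔 hσ _) (Ne.symm hne)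
    · rintro τ hτ s t ⟨hs, hs'⟩
      have hτ0 : τ 0 ≠ u := by
        intro h0
        have h1 := hs' τ hτ h0
        rw [(hH τ hτ).apply_edge] at h1
        rw [show s = 0 from Subtype.ext h1] at hs
        exact hs h0
      have hτ1 : τ 1 ≠ u := by
        intro h0
        have h1 := hs' (revEdge τ) (h𝓔.rev_mem τ hτ) (by simpa using h0)
        have h2 := (hH _ (h𝓔.rev_mem τ hτ)).apply_edge (unitInterval.symm s)
        rw [revEdge_apply, unitInterval.symm_symm, h1] at h2
        have h3 : unitInterval.symm s = 0 := Subtype.ext h2.symm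
        rw [show s = 1 by simpa using congrArg unitInterval.symm h3] at hs
        exact hs h0
      refine ⟨fun h0 => ?_, fun σ hσ h0 => ?_⟩
      · rcases eq_zero_or_one_of_mem_vertexSet hτ (h0 ▸ hu) with rfl | rfl
        · exact hτ0 h0
        · exact hτ1 h0
      · rw [(hH σ hσ).const τ hτ (fun h => hτ0 (h ▸ h0)) (fun h => hτ1 (by simpa [h] using h0)) t s]
        exact hs' σ hσ h0
  have : u ∈ A := hA ▸ mem_univ u
  exact this.1 rfl

/-- Two forward edges would put the image of their common vertex on two branches at once. The points
of positive height on both form a set containing each edge it meets, hence everything, yet the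
vertex is not in it. -/
theorem isForward_unique [LocallyPathConnectedSpace E] (hF : ∀ x, F x ≠ x) (hσ : σ ∈ 𝓔) (hτ : τ ∈ 𝓔) (h0 : σ 0 = τ 0)
    (hfσ : IsForward 𝓔 F σ) (hfτ : IsForward 𝓔 F τ) : σ = τ := by
  by_contra hne
  have hne' : σ ≠ revEdge τ := fun h => h𝓔.not_isForward_rev hfτ (h ▸ hfσ)
  have hne2 : τ ≠ revEdge σ := fun h => hne' (revEdge_eq_iff.1 h.symm)
  obtain ⟨h, hh⟩ := h𝓔.exists_isHeight hσ
  obtain ⟨k, hk⟩ := h𝓔.exists_isHeight hτ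
  have hconst : ∀ t, k (σ t) = 0 := fun t => by
    rw [hk.const σ hσ hne hne' t 0, h0, hk.apply_edge]; rfl
  have hconst' : ∀ t, h (τ t) = 0 := fun t => by
    rw [hh.const τ hτ (Ne.symm hne) hne2 t 0, ← h0, hh.apply_edge]; rfl
  have hA : {x | 0 < h x ∧ 0 < k x} = univ := by
    refine h𝓔.eq_univ_of_edges ⟨F (σ 0), h𝓔.pos_of_isForward hF hσ hfσ hh, ?_⟩ ?_
    · rw [h0]; exact h𝓔.pos_of_isForward hF hτ hfτ hk
    · rintro ρ hρ s t ⟨hs, hs'⟩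
      have h1 : ρ ≠ σ := by
        rintro rfl; rw [hconst] at hs'; exact lt_irrefl _ hs'
      have h2 : ρ ≠ revEdge σ := by
        rintro rfl; rw [revEdge_apply, hconst] at hs'; exact lt_irrefl _ hs'
      have h3 : ρ ≠ τ := by
        rintro rfl; rw [hconst'] at hs; exact lt_irrefl _ hs
      have h4 : ρ ≠ revEdge τ := by
        rintro rfl; rw [revEdge_apply, hconst'] at hs; exact lt_irrefl _ hs
      exact ⟨by rw [hh.const ρ hρ h1 h2 t s]; exact hs, by rw [hk.const ρ hρ h3 h4 t s]; exact hs'⟩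
  have : σ 0 ∈ {x | 0 < h x ∧ 0 < k x} := hA ▸ mem_univ _
  have h1 := this.1
  rw [hh.apply_edge] at h1
  exact lt_irrefl _ h1

end IsEdgeSystem

/-- The combinatorial flow of a fixed point free selfmap: `s y` is the next vertex from `y` in the
direction of `F y`, and `D y` is the set of points behind `y`. -/
structure IsFlow (𝓔 : Set C(unitInterval, E)) (F : C(E, E)) (s : vertexSet 𝓔 → vertexSet 𝓔)
    (D : vertexSet 𝓔 → Set E) : Prop where
  map_notMem : ∀ y : vertexSet 𝓔, F y ∉ D y
  subset : ∀ (y : vertexSet 𝓔) (Q : Set E), IsPreconnected Q → (y : E) ∉ Q → (Q ∩ D y).Nonempty → Q ⊆ D y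
  mem_iterate : ∀ (n : ℕ) q, (q : E) ∈ D (s^[n] q)
  succ_notMem : ∀ y, (s y : E) ∉ D y
  merge : ∀ q q', ∃ m n, s^[m] q = s^[n] q'
  exists_edge : ∀ y : vertexSet 𝓔, ∃ σ ∈ 𝓔, σ 0 = (y : E) ∧ σ 1 = (s y : E)
  equivariant : ∀ γ : E ≃ₜ E, (∀ σ : C(unitInterval, E), (γ : C(E, E)).comp σ ∈ 𝓔 ↔ σ ∈ 𝓔) →
    (∀ x, F (γ x) = γ (F x)) → ∀ y y' : vertexSet 𝓔, γ y = y' → γ (s y) = s y'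

theorem IsHeight.map_homeomorph {𝓔 : Set C(unitInterval, E)} {σ : C(unitInterval, E)} {h : E → ℝ}
    (hh : IsHeight 𝓔 σ h) (γ : E ≃ₜ E)
    (hγ : ∀ σ : C(unitInterval, E), (γ : C(E, E)).comp σ ∈ 𝓔 ↔ σ ∈ 𝓔) :
    IsHeight 𝓔 ((γ : C(E, E)).comp σ) (h ∘ γ.symm) where
  continuous := hh.continuous.comp γ.symm.continuous
  apply_edge t := by simp [hh.apply_edge]
  const τ hτ h1 h2 s t := by
    have hτ' : (γ : C(E, E)).comp ((γ.symm : C(E, E)).comp τ) = τ := by ext; simp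
    refine hh.const ((γ.symm : C(E, E)).comp τ) ((hγ _).1 (hτ'.symm ▸ hτ)) ?_ ?_ s t
    · rintro rfl; exact h1 hτ'.symm
    · intro h; rw [h] at hτ'; exact h2 hτ'.symm

theorem IsEdgeSystem.exists_isFlow [SimplyConnectedSpace E] [LocallyPathConnectedSpace E]
    {𝓔 : Set C(unitInterval, E)} (h𝓔 : IsEdgeSystem 𝓔) {F : C(E, E)} (hF : ∀ x, F x ≠ x) :
    ∃ s D, IsFlow 𝓔 F s D := by
  choose e he𝓔 he0 hef using fun y : vertexSet 𝓔 => h𝓔.exists_isForward hF y.2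
  choose H hH using fun y : vertexSet 𝓔 => h𝓔.exists_isHeight (he𝓔 y)
  let s : vertexSet 𝓔 → vertexSet 𝓔 := fun y => ⟨e y 1, h𝓔.one_mem_vertexSet (he𝓔 y)⟩
  have hstep : ∀ σ ∈ 𝓔, ∀ y y' : vertexSet 𝓔, σ 0 = y → σ 1 = y' → IsForward 𝓔 F σ → s y = y' := by
    intro σ hσ y y' h0 h1 hf
    apply Subtype.ext
    change e y 1 = y'
    rw [h𝓔.isForward_unique hF (he𝓔 y) hσ ((he0 y).trans h0.symm) (hef y) hf, h1]
  refine ⟨s, fun y => {x | H y x = 0}, ?_, ?_, ?_, ?_, ?_, ?_, ?_⟩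
  · intro y hy
    have := h𝓔.pos_of_isForward hF (he𝓔 y) (hef y) (hH y)
    rw [he0] at this
    exact this.ne' hy
  · rintro y Q hQ hyQ ⟨x, hxQ, hx0⟩ z hz
    exact (hH y).subset_of_isPreconnected h𝓔 (he𝓔 y) hQ (by rwa [he0]) hxQ hx0 hz
  · intro n
    induction n with
    | zero =>
      intro q
      have := (hH q).apply_edge 0
      rw [he0] at this
      exact this
    | succ n ih =>
      intro q
      -- With `y` the later vertex, the edge from `q` to `s q` is neither `e y`, whose far end has
      -- height 1, nor its reverse, which is not forward. So the height of `e y` is constant along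
      -- it, and `q` is behind `y` together with `s q`.
      have h1 : H (s^[n] (s q)) (e q 1) = 0 := ih (s q)
      change H (s^[n] (s q)) q = 0
      generalize s^[n] (s q) = y at h1
      by_cases hq1 : e q = e y
      · rw [hq1, (hH y).apply_edge] at h1
        norm_num at h1
      by_cases hq2 : e q = revEdge (e y)
      · exact (h𝓔.not_isForward_rev (hef y) (hq2 ▸ hef q)).elim
      · rw [← h1, ← (hH y).const _ (he𝓔 q) hq1 hq2 0 1, he0]
  · intro y hy
    have h1 : H y (e y 1) = 0 := hy
    rw [(hH y).apply_edge] at h1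
    norm_num at h1
  · intro q
    -- Of the two ends of an edge one is the image of the other under `s`, so `P` holds at both or
    -- at neither, and connectedness gives it everywhere.
    let P : vertexSet 𝓔 → Prop := fun q' => ∃ m n, s^[m] q = s^[n] q'
    have hPs : ∀ y, P (s y) ↔ P y := by
      intro y
      constructor
      · rintro ⟨m, n, h⟩
        exact ⟨m, n + 1, h⟩
      · rintro ⟨m, n, h⟩
        refine ⟨m + 1, n, ?_⟩
        rw [Function.iterate_succ_apply', h, ← Function.iterate_succ_apply' s,
          Function.iterate_succ_apply]
    have hPσ : ∀ σ (hσ : σ ∈ 𝓔), P ⟨σ 0, h𝓔.zero_mem_vertexSet hσ⟩ ↔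
        P ⟨σ 1, h𝓔.one_mem_vertexSet hσ⟩ := by
      intro σ hσ
      rcases h𝓔.isForward_or hF hσ with hf | hf
      · rw [← hPs ⟨σ 0, _⟩, hstep σ hσ ⟨σ 0, h𝓔.zero_mem_vertexSet hσ⟩
          ⟨σ 1, h𝓔.one_mem_vertexSet hσ⟩ rfl rfl hf]
      · rw [← hPs ⟨σ 1, _⟩, hstep _ (h𝓔.rev_mem σ hσ) ⟨σ 1, h𝓔.one_mem_vertexSet hσ⟩
          ⟨σ 0, h𝓔.zero_mem_vertexSet hσ⟩ (by simp) (by simp) hf]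
    have hA : {x | (∃ hx : x ∈ vertexSet 𝓔, P ⟨x, hx⟩) ∨
        ∃ σ, ∃ hσ : σ ∈ 𝓔, P ⟨σ 0, h𝓔.zero_mem_vertexSet hσ⟩ ∧ ∃ t ∈ openInterval, σ t = x} = univ := by
      refine h𝓔.eq_univ_of_edges ⟨q, Or.inl ⟨q.2, 0, 0, rfl⟩⟩ ?_
      intro τ hτ a b ha
      have hτ0 : P ⟨τ 0, h𝓔.zero_mem_vertexSet hτ⟩ := by
        rcases ha with ⟨hx, hP⟩ | ⟨σ, hσ, hP, t, ht, he⟩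
        · rcases eq_zero_or_one_of_mem_vertexSet hτ hx with rfl | rfl
          · exact hP
          · exact (hPσ τ hτ).2 hP
        · rcases h𝓔.eq_or_eq_rev σ hσ τ hτ t a ht he with rfl | rfl
          · exact hP
          · have := (hPσ σ hσ).1 hP
            simpa using this
      by_cases hb : b ∈ openInterval
      · exact Or.inr ⟨τ, hτ, hτ0, b, hb, rfl⟩
      · left
        rcases eq_zero_or_one_of_notMem hb with rfl | rfl
        · exact ⟨_, hτ0⟩
        · exact ⟨_, (hPσ τ hτ).1 hτ0⟩
    intro q'
    have hq' : (q' : E) ∈ {x | (∃ hx : x ∈ vertexSet 𝓔, P ⟨x, hx⟩) ∨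
        ∃ σ, ∃ hσ : σ ∈ 𝓔, P ⟨σ 0, h𝓔.zero_mem_vertexSet hσ⟩ ∧ ∃ t ∈ openInterval, σ t = x} :=
      hA ▸ mem_univ _
    rcases hq' with ⟨_, h⟩ | ⟨σ, hσ, -, t, ht, he⟩
    · exact h
    · exact (q'.2 σ hσ t ht he).elim
  · exact fun y => ⟨e y, he𝓔 y, he0 y, rfl⟩
  · intro γ hγ hFγ y y' hy
    have := hstep ((γ : C(E, E)).comp (e y)) ((hγ _).2 (he𝓔 y)) y' ⟨γ (e y 1),
      h𝓔.one_mem_vertexSet ((hγ _).2 (he𝓔 y))⟩ (by simp [he0, hy]) rfl ?_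
    · rw [this]
    · obtain ⟨h, hh, hf⟩ := hef y
      refine ⟨_, hh.map_homeomorph γ hγ, fun t ht => ?_⟩
      simpa [hFγ] using hf t ht

end Flow

/-! ### Prefixes and norms in free groups -/

section FreeGroupWords

variable {ι : Type*} [DecidableEq ι]

-- The letters of `K` are multiplied one at a time: each either cancels the last letter of `R` or
-- extends `R`, so the cancellation never reaches `L`.
open FreeGroup in
theorem prefix_toWord_mul {L R K : List (ι × Bool)} (hLR : IsReduced (L ++ R)) (hK : IsReduced K)
    (hlen : K.length ≤ R.length) : L <+: (mk (L ++ R) * mk K).toWord := by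
  induction K generalizing R with
  | nil =>
    rw [← one_eq_mk, mul_one, toWord_mk, hLR.reduce_eq]
    exact List.prefix_append _ _
  | cons a K ih =>
    obtain ⟨R', z, rfl⟩ := R.eq_nil_or_concat.resolve_left (by rintro rfl; simp at hlen)
    have hK' : IsReduced K := hK.infix (List.suffix_cons a K).isInfix
    by_cases hz : z = (a.1, !a.2)
    · have : (mk (L ++ R'.concat z) * mk (a :: K) : FreeGroup ι) = mk (L ++ R') * mk K := by
        rw [mul_mk, mul_mk, hz]
        refine Quot.sound ?_
        have := Red.Step.not (L₁ := L ++ R') (L₂ := K) (x := a.1) (b := !a.2)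
        simpa using this
      rw [this]
      refine ih (hLR.infix ?_) hK' (by simp at hlen; omega)
      rw [List.concat_eq_append, ← List.append_assoc]
      exact (List.prefix_append _ _).isInfix
    · have hred : IsReduced (L ++ R'.concat z ++ [a]) := by
        have h2 : IsReduced ([z] ++ [a]) := by
          change IsReduced [z, a]
          rw [isReduced_cons_cons]
          refine ⟨fun h1 => ?_, IsReduced.singleton⟩
          by_contra h2
          exact hz (Prod.ext h1 (by cases hz2 : z.2 <;> cases ha2 : a.2 <;> simp_all))
        rw [List.concat_eq_append, ← List.append_assoc] at hLR ⊢
        exact hLR.append_overlap h2 (by simp)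
      have : (mk (L ++ R'.concat z) * mk (a :: K) : FreeGroup ι) =
          mk (L ++ (R'.concat z ++ [a])) * mk K := by
        rw [mul_mk, mul_mk]; simp
      rw [this]
      refine ih (by simpa using hred) hK' (by simp at hlen ⊢; omega)

/-- If a long prefix of `g` is not a prefix of `g'`, then the distance from `g` to this prefix is at
most the distance from `g` to `g'`. -/
theorem norm_le_of_prefix {L : List (ι × Bool)} {g g' : FreeGroup ι} (hg : L <+: g.toWord)
    (hg' : ¬ L <+: g'.toWord) : ((FreeGroup.mk L)⁻¹ * g).norm ≤ (g⁻¹ * g').norm := by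
  by_contra! hlt
  obtain ⟨R, hR⟩ := hg
  have hgeq : g = FreeGroup.mk (L ++ R) := by rw [hR, FreeGroup.mk_toWord]
  have hLR : FreeGroup.IsReduced (L ++ R) := hR ▸ FreeGroup.isReduced_toWord
  have hRnorm : ((FreeGroup.mk L)⁻¹ * g).norm ≤ R.length := by
    rw [hgeq, ← FreeGroup.mul_mk, inv_mul_cancel_left]
    exact FreeGroup.norm_mk_le
  refine hg' ?_
  have := prefix_toWord_mul hLR (FreeGroup.isReduced_toWord (x := g⁻¹ * g')) (hlt.le.trans hRnorm)
  rwa [← hgeq, FreeGroup.mk_toWord, mul_inv_cancel_left] at this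

theorem finite_norm_le [Finite ι] (n : ℕ) : {g : FreeGroup ι | g.norm ≤ n}.Finite :=
  Set.Finite.of_finite_image ((List.finite_length_le (ι × Bool) n).subset
    (by rintro _ ⟨g, hg, rfl⟩; exact hg)) FreeGroup.toWord_injective.injOn

namespace InfWord

omit [DecidableEq ι] in
@[simp] theorem length_initial (W : InfWord ι) (i : ℕ) : (W.initial i).length = i := by
  simp [initial]

omit [DecidableEq ι] in
theorem take_initial (W : InfWord ι) {m i : ℕ} (h : m ≤ i) :
    (W.initial i).take m = W.initial m := by
  apply List.ext_getElem
  · simpa using h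
  · intro k h1 h2
    simp [initial]

omit [DecidableEq ι] in
theorem initial_prefix (W : InfWord ι) {m i : ℕ} (h : m ≤ i) : W.initial m <+: W.initial i := by
  rw [← W.take_initial h]
  exact List.take_prefix _ _

omit [DecidableEq ι] in
theorem isReduced_initial (W : InfWord ι) (i : ℕ) : FreeGroup.IsReduced (W.initial i) := by
  rw [FreeGroup.IsReduced, initial, List.isChain_ofFn]
  intro j hj
  exact W.reduced j

theorem toWord_mk_initial (W : InfWord ι) (i : ℕ) :
    (FreeGroup.mk (W.initial i)).toWord = W.initial i := by
  rw [FreeGroup.toWord_mk, (W.isReduced_initial i).reduce_eq]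

theorem norm_mk_initial (W : InfWord ι) (i : ℕ) : (FreeGroup.mk (W.initial i)).norm = i := by
  rw [FreeGroup.norm, toWord_mk_initial, length_initial]

theorem initial_prefix_of_le_meetLength (W : InfWord ι) {V : FreeGroup ι} {i : ℕ}
    (h : i ≤ W.meetLength V) : W.initial i <+: V.toWord := by
  have h1 : V.toWord.take (W.meetLength V) = W.initial (W.meetLength V) :=
    Nat.findGreatest_spec (P := fun k => V.toWord.take k = W.initial k) (Nat.zero_le _)
      (by simp [initial])
  exact (W.initial_prefix h).trans (h1 ▸ List.take_prefix _ _)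

theorem meetLength_le_norm (W : InfWord ι) (V : FreeGroup ι) : W.meetLength V ≤ V.norm :=
  Nat.findGreatest_le _

omit [DecidableEq ι] in
theorem eq_of_initial_eq {W W' : InfWord ι} (h : ∀ i, W.initial i = W'.initial i) : W = W' := by
  have : W.letter = W'.letter := by
    funext k
    have h1 := h (k + 1)
    simp only [initial, List.ofFn_inj] at h1
    exact congrFun h1 ⟨k, k.lt_succ_self⟩
  cases W; cases W'; simp_all

omit [DecidableEq ι] in
theorem eq_of_prefix {W W' : InfWord ι}
    (h : ∀ i, ∃ L : List (ι × Bool), W.initial i <+: L ∧ W'.initial i <+: L) : W = W' := by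
  refine eq_of_initial_eq fun i => ?_
  obtain ⟨L, h1, h2⟩ := h i
  exact (List.prefix_of_prefix_length_le h1 h2 (by simp)).eq_of_length (by simp)

/-- For an attracting fixed word, `φ(W_i)` is eventually much farther along `W` than `W_i`. -/
theorem IsAttracting.eventually {φ : FreeGroup ι →* FreeGroup ι} {W : InfWord ι}
    (hW : W.IsAttracting φ) (D : ℕ) : ∀ᶠ i in atTop,
      W.initial i <+: (φ (FreeGroup.mk (W.initial i))).toWord ∧
      D < ((FreeGroup.mk (W.initial i))⁻¹ * φ (FreeGroup.mk (W.initial i))).norm := by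
  filter_upwards [hW.2.eventually_gt_atTop (D : ℤ)] with i hi
  refine ⟨W.initial_prefix_of_le_meetLength (by omega), ?_⟩
  set P := FreeGroup.mk (W.initial i)
  have h1 := W.meetLength_le_norm (φ P)
  have h2 := FreeGroup.norm_mul_le P (P⁻¹ * φ P)
  rw [mul_inv_cancel_left, W.norm_mk_initial] at h2
  omega

end InfWord

end FreeGroupWords

/-! ### Selfmaps commuting with a free action -/

section Orbits

variable {V : Type*} {s : V → V}

theorem iterate_injective_of_acyclic (hs : ∀ n y, s^[n + 1] y ≠ y) (y : V) :
    Function.Injective fun n => s^[n] y := by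
  intro a b
  wlog hab : a < b generalizing a b
  · intro h
    rcases eq_or_lt_of_le (not_lt.1 hab) with h' | h'
    · exact h'.symm
    · exact (this h' h.symm).symm
  · intro h
    obtain ⟨k, rfl⟩ := Nat.exists_eq_add_of_lt hab
    have h' : s^[a] y = s^[a + k + 1] y := h
    rw [show a + k + 1 = (k + 1) + a by ring, Function.iterate_add_apply] at h'
    exact (hs k _ h'.symm).elim

/-- A group acting freely and commuting with an acyclic selfmap whose orbits merge is cyclic. -/
theorem isCyclic_of_acyclic {G : Type*} [Group G] [MulAction G V]
    (hfree : ∀ (g : G) (y : V), g • y = y → g = 1) (hcomm : ∀ (g : G) y, s (g • y) = g • s y)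
    (hs : ∀ n y, s^[n + 1] y ≠ y) (hmerge : ∀ y y', ∃ m n, s^[m] y = s^[n] y') (y : V) :
    IsCyclic G := by
  have hcomm' : ∀ (g : G) n z, s^[n] (g • z) = g • s^[n] z := fun g n z =>
    ((Function.Semiconj.iterate_right (f := (g • ·)) (ga := s) (gb := s)
      (fun z => (hcomm g z).symm) n) z).symm
  have hinj := iterate_injective_of_acyclic hs y
  choose m n hmn using fun g : G => hmerge y (g • y)
  -- The difference `a - b` depends on `g` alone because the orbit of `y` is injective; it is the
  -- translation number of `g`.
  have key : ∀ (g : G) a b, s^[a] y = g • s^[b] y → (a : ℤ) - b = m g - n g := by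
    intro g a b h
    have h1 : s^[n g + a] y = s^[b + m g] y := by
      rw [Function.iterate_add_apply, h, hcomm', ← Function.iterate_add_apply, add_comm (n g) b,
        Function.iterate_add_apply, ← hcomm', ← hcomm', ← hmn, Function.iterate_add_apply]
    have := hinj h1
    omega
  have hmn' : ∀ g : G, s^[m g] y = g • s^[n g] y := fun g => by rw [hmn, hcomm']
  let τ : G →* Multiplicative ℤ := MonoidHom.mk' (fun g => Multiplicative.ofAdd ((m g : ℤ) - n g))
    (fun g k => by
      rw [← ofAdd_add]
      congr 1
      have h1 : s^[m k + m g] y = (g * k) • s^[n g + n k] y := by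
        rw [Function.iterate_add_apply, hmn', hcomm', ← Function.iterate_add_apply, add_comm (m k),
          Function.iterate_add_apply, hmn', hcomm', ← Function.iterate_add_apply, mul_smul]
      have := key _ _ _ h1
      push_cast at this
      omega)
  -- Translation number 0 means that `g` fixes a point of the orbit, which freeness forbids unless
  -- `g = 1`.
  refine isCyclic_of_injective τ ((injective_iff_map_eq_one τ).2 fun g hg => ?_)
  have h0 : (m g : ℤ) - n g = 0 := Multiplicative.ofAdd.injective hg
  have h1 := hmn' g
  rw [show m g = n g by omega] at h1
  exact hfree g _ h1.symm

end Orbits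

theorem groupRank_le_one (G : Type*) [Group G] [IsCyclic G] : groupRank G ≤ 1 := by
  obtain ⟨g, hg⟩ := IsCyclic.exists_generator (α := G)
  refine (iInf_le _ ⟨{g}, ?_⟩).trans (by simp)
  rw [← Subgroup.zpowers_eq_closure]
  exact (Subgroup.eq_top_iff' _).2 hg

theorem groupRank_eq_zero (G : Type*) [Group G] [Subsingleton G] : groupRank G = 0 := by
  refine le_antisymm ((iInf_le _ ⟨∅, Subsingleton.elim _ _⟩).trans (by simp)) bot_le

/-! ### Covering transformations of the universal covering -/

section Deck

variable {X : Type u} [TopologicalSpace X] {E : Type v} [TopologicalSpace E] {p : C(E, X)}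

theorem eq_of_covering_eq [PreconnectedSpace E] (hp : IsCoveringMap p) {g h : C(E, E)}
    (hg : ∀ x, p (g x) = p (h x)) {a : E} (ha : g a = h a) : g = h :=
  DFunLike.coe_injective <| hp.eq_of_comp_eq g.continuous h.continuous (funext hg) a ha

theorem deck_eq_one [PreconnectedSpace E] (hp : IsCoveringMap p) (γ : deckGroup p) {x : E}
    (h : γ.1 x = x) : γ = 1 := by
  have := eq_of_covering_eq hp (g := (γ.1 : C(E, E))) (h := ContinuousMap.id E) γ.2 (a := x) h
  apply Subtype.ext
  ext y
  exact DFunLike.congr_fun this y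

theorem exists_deck [LocallyPathConnectedSpace X] (hp : IsUniversalCovering p) {x y : E}
    (h : p x = p y) : ∃ γ : deckGroup p, γ.1 x = y := by
  have := hp.simplyConnected
  have := locallyPathConnectedSpace_of_covering hp.isCoveringMap
  have cov := hp.isCoveringMap
  obtain ⟨g, ⟨hg0, hgp⟩, -⟩ := cov.existsUnique_continuousMap_lifts p x y h.symm
  obtain ⟨k, ⟨hk0, hkp⟩, -⟩ := cov.existsUnique_continuousMap_lifts p y x h
  have hgp' : ∀ x, p (g x) = p x := fun x => congrFun hgp x
  have hkp' : ∀ x, p (k x) = p x := fun x => congrFun hkp x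
  have hkg : k.comp g = ContinuousMap.id E :=
    eq_of_covering_eq cov (fun x => by simp [hgp', hkp']) (a := x) (by simp [hg0, hk0])
  have hgk : g.comp k = ContinuousMap.id E :=
    eq_of_covering_eq cov (fun x => by simp [hgp', hkp']) (a := y) (by simp [hg0, hk0])
  exact ⟨⟨{ toFun := g
            invFun := k
            left_inv := fun x => DFunLike.congr_fun hkg x
            right_inv := fun x => DFunLike.congr_fun hgk x
            continuous_toFun := g.continuous
            continuous_invFun := k.continuous }, hgp'⟩, hg0⟩

theorem IsUniversalCovering.surjective [LocallyPathConnectedSpace X] [ConnectedSpace X]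
    (hp : IsUniversalCovering p) : Function.Surjective p := by
  have := hp.simplyConnected
  obtain ⟨e⟩ : Nonempty E := inferInstance
  have : PathConnectedSpace X := pathConnectedSpace_iff_connectedSpace.2 inferInstance
  intro x
  let γ := PathConnectedSpace.somePath (p e) x
  obtain ⟨Γ, hΓ, -⟩ := hp.isCoveringMap.exists_path_lifts (γ : C(unitInterval, X)) e γ.source
  exact ⟨Γ 1, (congrFun hΓ 1).trans γ.target⟩

/-- An equivariant map from the universal covering to the group of covering transformations. -/
theorem exists_equivariant [LocallyPathConnectedSpace X] [ConnectedSpace X]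
    (hp : IsUniversalCovering p) : ∃ θ : E → deckGroup p, (∀ (γ : deckGroup p) x,
      θ (γ.1 x) = γ * θ x) ∧ ∀ x y, p x = p y → θ x = θ y → x = y := by
  have := hp.simplyConnected
  -- `r` picks a base point in each fibre, and `θ x` is the transformation carrying it to `x`.
  choose r hr using hp.surjective
  choose θ hθ using fun x : E => exists_deck hp (hr (p x))
  refine ⟨θ, fun γ x => ?_, fun x y h1 h2 => ?_⟩
  · have h1 := hθ (γ.1 x)
    rw [γ.2 x] at h1
    have h2 : ((γ * θ x)⁻¹ * θ (γ.1 x)).1 (r (p x)) = r (p x) := by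
      change (γ * θ x).1.symm ((θ (γ.1 x)).1 (r (p x))) = _
      rw [h1, Homeomorph.symm_apply_eq]
      exact congrArg γ.1 (hθ x).symm
    exact (inv_mul_eq_one.1 (deck_eq_one hp.isCoveringMap _ h2)).symm
  · rw [← hθ x, ← hθ y, h1, h2]

end Deck

/-! ### The edge system of a covering of a finite graph -/

section Graph

open RelCWComplex

variable {X : Type u} [TopologicalSpace X] [CWComplex (univ : Set X)]

/-- The characteristic map of a `1`-cell, parametrized by the unit interval. -/
def edgeMap (j : cell (univ : Set X) 1) : C(unitInterval, X) where
  toFun t := map 1 j fun _ => 2 * (t : ℝ) - 1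
  continuous_toFun := by
    refine (RelCWComplex.continuousOn 1 j).comp_continuous (by fun_prop) fun t => ?_
    rw [mem_closedBall_zero_iff, pi_norm_le_iff_of_nonneg zero_le_one]
    intro _
    rw [Real.norm_eq_abs, abs_le]
    constructor <;> linarith [t.2.1, t.2.2]

theorem edge_mem_ball {t : unitInterval} (ht : t ∈ openInterval) :
    (fun _ : Fin 1 => 2 * (t : ℝ) - 1) ∈ Metric.ball (0 : Fin 1 → ℝ) 1 := by
  have h0 : (0 : ℝ) < t := ht.1
  have h1 : (t : ℝ) < 1 := ht.2
  rw [mem_ball_zero_iff, pi_norm_lt_iff zero_lt_one]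
  intro _
  rw [Real.norm_eq_abs, abs_lt]
  constructor <;> linarith

theorem edgeMap_mem_openCell (j : cell (univ : Set X) 1) {t : unitInterval}
    (ht : t ∈ openInterval) : edgeMap j t ∈ openCell 1 j :=
  ⟨_, edge_mem_ball ht, rfl⟩

theorem edgeMap_injOn (j : cell (univ : Set X) 1) : InjOn (edgeMap j) openInterval := by
  intro s hs t ht h
  have h1 := (map 1 j).injOn (by rw [RelCWComplex.source_eq]; exact edge_mem_ball hs)
    (by rw [RelCWComplex.source_eq]; exact edge_mem_ball ht) h
  have h2 := congrFun h1 0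
  apply Subtype.ext
  linarith

theorem exists_edgeMap_eq_of_mem_closedCell (j : cell (univ : Set X) 1) {x : X} (hx : x ∈ closedCell 1 j) :
    ∃ t, edgeMap j t = x := by
  obtain ⟨y, hy, rfl⟩ := hx
  rw [mem_closedBall_zero_iff, pi_norm_le_iff_of_nonneg zero_le_one] at hy
  have h0 := hy 0
  rw [Real.norm_eq_abs, abs_le] at h0
  refine ⟨⟨(y 0 + 1) / 2, by linarith, by linarith⟩, ?_⟩
  refine congrArg (map 1 j) (funext fun i => ?_)
  rw [Subsingleton.elim i 0]
  change 2 * ((y 0 + 1) / 2) - 1 = y 0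
  ring

/-- The `0`-skeleton. -/
def cwVertices (X : Type u) [TopologicalSpace X] [CWComplex (univ : Set X)] : Set X :=
  range fun i : cell (univ : Set X) 0 => map 0 i 0

theorem eq_of_mem_closedCell_zero (i : cell (univ : Set X) 0) {x : X} (hx : x ∈ closedCell 0 i) :
    x = map 0 i 0 := by
  obtain ⟨y, -, rfl⟩ := hx
  rw [Subsingleton.elim y 0]

theorem edgeMap_mem_cwVertices (j : cell (univ : Set X) 1) {t : unitInterval}
    (ht : t ∉ openInterval) : edgeMap j t ∈ cwVertices X := by
  obtain ⟨I, hI⟩ := CWComplex.mapsTo (C := (univ : Set X)) 1 j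
  have hs : (fun _ : Fin 1 => 2 * (t : ℝ) - 1) ∈ Metric.sphere (0 : Fin 1 → ℝ) 1 := by
    rw [mem_sphere_zero_iff_norm, pi_norm_const, Real.norm_eq_abs]
    rcases eq_zero_or_one_of_notMem ht with rfl | rfl <;> norm_num
  have := hI hs
  simp only [mem_iUnion] at this
  obtain ⟨m, hm, i, -, hx⟩ := this
  obtain rfl : m = 0 := by omega
  exact ⟨i, (eq_of_mem_closedCell_zero i hx).symm⟩

theorem notMem_cwVertices {j : cell (univ : Set X) 1} {x : X} (hx : x ∈ openCell 1 j) :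
    x ∉ cwVertices X := by
  rintro ⟨i, rfl⟩
  exact Set.disjoint_left.1 (RelCWComplex.disjoint_openCell_of_ne (C := (univ : Set X))
    (i := j) (j := i) (by simp)) hx (RelCWComplex.map_zero_mem_openCell 0 i)

theorem edgeMap_eq {j k : cell (univ : Set X) 1} {s t : unitInterval} (hs : s ∈ openInterval)
    (h : edgeMap j s = edgeMap k t) : j = k ∧ s = t := by
  have ht : t ∈ openInterval := by
    by_contra ht
    exact notMem_cwVertices (edgeMap_mem_openCell j hs) (h ▸ edgeMap_mem_cwVertices k ht)
  have hjk : j = k := by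
    by_contra hne
    exact Set.disjoint_left.1 (RelCWComplex.disjoint_openCell_of_ne (C := (univ : Set X))
      (i := j) (j := k) (by simpa using hne)) (edgeMap_mem_openCell j hs)
      (h ▸ edgeMap_mem_openCell k ht)
  subst hjk
  exact ⟨rfl, edgeMap_injOn j hs ht h⟩

theorem mem_vertices_or_edge
    (hdim : ∀ n : ℕ, 2 ≤ n → IsEmpty (RelCWComplex.cell (Set.univ : Set X) n)) (x : X) :
    x ∈ cwVertices X ∨ ∃ j t, edgeMap j t = x := by
  have hx : x ∈ ⋃ (n : ℕ) (j : cell (univ : Set X) n), closedCell n j := by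
    rw [CWComplex.union]; trivial
  simp only [mem_iUnion] at hx
  obtain ⟨n, j, hj⟩ := hx
  match n, j, hj with
  | 0, j, hj => exact Or.inl ⟨j, (eq_of_mem_closedCell_zero j hj).symm⟩
  | 1, j, hj => exact Or.inr ⟨j, exists_edgeMap_eq_of_mem_closedCell j hj⟩
  | n + 2, j, _ => exact ((hdim (n + 2) (by omega)).false j).elim

variable {E : Type v} [TopologicalSpace E] {p : C(E, X)}

/-- The lifts of the characteristic maps of the `1`-cells, in both directions. -/
def edgeLifts (p : C(E, X)) : Set C(unitInterval, E) :=
  {σ | ∃ j : cell (univ : Set X) 1, p.comp σ = edgeMap j ∨ p.comp σ = revEdge (edgeMap j)}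

omit [CWComplex (univ : Set X)] in
theorem exists_lift (hp : IsCoveringMap p) (c : C(unitInterval, X)) (t : unitInterval) {x : E}
    (hx : p x = c t) : ∃ σ : C(unitInterval, E), p.comp σ = c ∧ σ t = x := by
  have : LocallyPathConnectedSpace unitInterval := (convex_Icc (0 : ℝ) 1).locallyPathConnectedSpace
  have : ContractibleSpace unitInterval := (convex_Icc (0 : ℝ) 1).contractibleSpace ⟨0, by simp⟩
  have : SimplyConnectedSpace unitInterval := SimplyConnectedSpace.ofContractible _
  obtain ⟨σ, ⟨h1, h2⟩, -⟩ := hp.existsUnique_continuousMap_lifts c t x hx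
  exact ⟨σ, DFunLike.coe_injective h2, h1⟩

omit [CWComplex (univ : Set X)] in
theorem lift_unique (hp : IsCoveringMap p) {σ τ : C(unitInterval, E)}
    (h : p.comp σ = p.comp τ) {t : unitInterval} (ht : σ t = τ t) : σ = τ :=
  DFunLike.coe_injective <| hp.eq_of_comp_eq σ.continuous τ.continuous
    (funext fun x => DFunLike.congr_fun h x) t ht

theorem revEdge_mem_edgeLifts {σ : C(unitInterval, E)} (hσ : σ ∈ edgeLifts p) :
    revEdge σ ∈ edgeLifts p := by
  have hr : p.comp (revEdge σ) = revEdge (p.comp σ) := rfl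
  obtain ⟨j, h | h⟩ := hσ
  · exact ⟨j, Or.inr (by rw [hr, h])⟩
  · exact ⟨j, Or.inl (by rw [hr, h, revEdge_revEdge])⟩

theorem exists_edgeMap_of_mem {σ : C(unitInterval, E)} (hσ : σ ∈ edgeLifts p) :
    (∃ j, p.comp σ = edgeMap j) ∨ ∃ j, p.comp (revEdge σ) = edgeMap j := by
  obtain ⟨j, h | h⟩ := hσ
  · exact Or.inl ⟨j, h⟩
  · exact Or.inr ⟨j, by
      rw [show p.comp (revEdge σ) = revEdge (p.comp σ) from rfl, h, revEdge_revEdge]⟩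

theorem comp_mem_edgeLifts (γ : deckGroup p) (σ : C(unitInterval, E)) :
    (γ.1 : C(E, E)).comp σ ∈ edgeLifts p ↔ σ ∈ edgeLifts p := by
  have : p.comp ((γ.1 : C(E, E)).comp σ) = p.comp σ := by
    ext t; exact γ.2 (σ t)
  simp only [edgeLifts, mem_ofPred_eq, this]

theorem edgeLifts_overlap (hp : IsCoveringMap p) {σ τ : C(unitInterval, E)}
    (hσ : ∃ j, p.comp σ = edgeMap j) (hτ : ∃ j, p.comp τ = edgeMap j) {s t : unitInterval}
    (hs : s ∈ openInterval) (h : σ s = τ t) : τ = σ ∧ s = t := by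
  obtain ⟨j, hj⟩ := hσ
  obtain ⟨k, hk⟩ := hτ
  have h1 : edgeMap j s = edgeMap k t := by
    rw [← hj, ← hk]; exact congrArg p h
  obtain ⟨rfl, rfl⟩ := edgeMap_eq hs h1
  exact ⟨(lift_unique hp (hj.trans hk.symm) h).symm, rfl⟩

/-- There are finitely many cells, so an ultrafilter on `A` converging to `x` lives over the
vertices or over one closed edge. In the first case it contains the fibre of `p x`, hence the point
`x` by local injectivity. In the second the edge parameters converge by compactness, and the lift of
the edge through `x` carries the ultrafilter. -/
theorem isClosed_of_edgeLifts [T2Space X] [CWComplex.Finite (univ : Set X)]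
    (hdim : ∀ n : ℕ, 2 ≤ n → IsEmpty (RelCWComplex.cell (Set.univ : Set X) n))
    (hp : IsCoveringMap p) (A : Set E) (hA : ∀ σ ∈ edgeLifts p, IsClosed (σ ⁻¹' A)) :
    IsClosed A := by
  have hfin : Finite (Σ n, cell (univ : Set X) n) := RelCWComplex.finite_cells_of_finite
  have hfin0 : Finite (cell (univ : Set X) 0) :=
    Finite.of_injective (fun i => (⟨0, i⟩ : Σ n, cell (univ : Set X) n)) fun a b h => by simpa using h
  have hfin1 : Finite (cell (univ : Set X) 1) :=
    Finite.of_injective (fun i => (⟨1, i⟩ : Σ n, cell (univ : Set X) n)) fun a b h => by simpa using h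
  rw [isClosed_iff_ultrafilter]
  intro x 𝒰 hx hA𝒰
  have hpx : Tendsto p 𝒰 (𝓝 (p x)) := (p.continuous.tendsto x).mono_left hx
  obtain ⟨e, hxe, he⟩ := hp.isLocalHomeomorph x
  have hN : e.source ∈ 𝒰 := hx (e.open_source.mem_nhds hxe)
  have hinj : InjOn p e.source := by rw [he]; exact e.injOn
  have hcover : (p ⁻¹' cwVertices X ∪ ⋃ j : cell (univ : Set X) 1, p ⁻¹' range (edgeMap j)) ∈ 𝒰 := by
    refine univ_mem' fun y => ?_
    rcases mem_vertices_or_edge hdim (p y) with h | ⟨j, t, h⟩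
    · exact Or.inl h
    · exact Or.inr (mem_iUnion.2 ⟨j, t, h⟩)
  rcases Ultrafilter.union_mem_iff.1 hcover with h | h
  · have hcl : IsClosed (cwVertices X \ {p x}) :=
      ((finite_range _).subset sdiff_subset).isClosed
    have hmem : p ⁻¹' (cwVertices X \ {p x})ᶜ ∈ 𝒰 :=
      hpx (hcl.isOpen_compl.mem_nhds (by simp))
    obtain ⟨y, ⟨⟨hy1, hy2⟩, hy3⟩, hy4⟩ :=
      𝒰.neBot.nonempty_of_mem (inter_mem (inter_mem (inter_mem h hmem) hN) hA𝒰)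
    have hpy : p y = p x := by
      by_contra hne
      exact hy2 ⟨hy1, hne⟩
    exact hinj hy3 hxe hpy ▸ hy4
  · obtain ⟨j, hj⟩ := Ultrafilter.eventually_exists_iff.1
      (show ∀ᶠ y in 𝒰, ∃ j : cell (univ : Set X) 1, y ∈ p ⁻¹' range (edgeMap j) from by
        filter_upwards [h] with y hy using mem_iUnion.1 hy)
    have : Nonempty unitInterval := ⟨0⟩
    choose! T hT using fun (y : E) (hy : y ∈ p ⁻¹' range (edgeMap j)) => hy
    obtain ⟨t, ht⟩ : ∃ t, Tendsto T 𝒰 (𝓝 t) := by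
      obtain ⟨t, -, ht⟩ := isCompact_univ.ultrafilter_le_nhds (𝒰.map T) (by simp)
      exact ⟨t, ht⟩
    have hpx' : Tendsto p 𝒰 (𝓝 (edgeMap j t)) := by
      refine (((edgeMap j).continuous.tendsto t).comp ht).congr' ?_
      filter_upwards [hj] with y hy using hT y hy
    obtain ⟨σ, hσ, hσt⟩ := exists_lift hp (edgeMap j) t (tendsto_nhds_unique hpx hpx')
    have hσT : Tendsto (fun y => σ (T y)) 𝒰 (𝓝 x) := by
      have := (σ.continuous.tendsto t).comp ht
      rwa [hσt] at this
    -- Both points lie over the same point of `X` and in one sheet around `x`.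
    have heq : ∀ᶠ y in 𝒰, σ (T y) = y := by
      filter_upwards [hj, hN, hσT (e.open_source.mem_nhds hxe)] with y hy1 hy2 hy3
      refine hinj hy3 hy2 ?_
      rw [← hT y hy1, ← hσ]
      rfl
    have hmem : t ∈ σ ⁻¹' A := by
      refine (hA σ ⟨j, Or.inl hσ⟩).mem_of_tendsto ht ?_
      filter_upwards [heq, hA𝒰] with y hy1 hy2
      rw [mem_preimage, hy1]
      exact hy2
    exact hσt ▸ hmem

theorem isEdgeSystem_edgeLifts [T2Space X] [CWComplex.Finite (univ : Set X)]
    (hdim : ∀ n : ℕ, 2 ≤ n → IsEmpty (RelCWComplex.cell (Set.univ : Set X) n))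
    (hp : IsCoveringMap p) : IsEdgeSystem (edgeLifts p) where
  rev_mem _ := revEdge_mem_edgeLifts
  inj σ hσ s t hs h := by
    rcases exists_edgeMap_of_mem hσ with hj | hj
    · exact (edgeLifts_overlap hp hj hj hs h).2
    · have := (edgeLifts_overlap hp hj hj (s := unitInterval.symm s) (t := unitInterval.symm t)
        (symm_mem_openInterval.2 hs) (by simpa using h)).2
      simpa using this
  eq_or_eq_rev σ hσ τ hτ s t hs h := by
    rcases exists_edgeMap_of_mem hσ with hj | hj <;> rcases exists_edgeMap_of_mem hτ with hk | hk
    · exact Or.inl (edgeLifts_overlap hp hj hk hs h).1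
    · exact Or.inr (revEdge_eq_iff.1 (edgeLifts_overlap hp hj hk (t := unitInterval.symm t)
        hs (by simpa using h)).1)
    · exact Or.inr (edgeLifts_overlap hp hj hk (s := unitInterval.symm s)
        (symm_mem_openInterval.2 hs) (by simpa using h)).1
    · left
      have := (edgeLifts_overlap hp hj hk (s := unitInterval.symm s) (t := unitInterval.symm t)
        (symm_mem_openInterval.2 hs) (by simpa using h)).1
      rw [revEdge_eq_iff, revEdge_revEdge] at this
      exact this
  isClosed_of_preimage := isClosed_of_edgeLifts hdim hp

theorem mem_vertexSet_edgeLifts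
    (hdim : ∀ n : ℕ, 2 ≤ n → IsEmpty (RelCWComplex.cell (Set.univ : Set X) n))
    (hp : IsCoveringMap p) {x : E} : x ∈ vertexSet (edgeLifts p) ↔ p x ∈ cwVertices X := by
  constructor
  · intro hx
    rcases mem_vertices_or_edge hdim (p x) with h | ⟨j, t, h⟩
    · exact h
    · by_cases ht : t ∈ openInterval
      · obtain ⟨σ, hσ, hσt⟩ := exists_lift hp (edgeMap j) t h.symm
        exact (hx σ ⟨j, Or.inl hσ⟩ t ht hσt).elim
      · exact h ▸ edgeMap_mem_cwVertices j ht
  · rintro hx σ hσ t ht rfl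
    rcases exists_edgeMap_of_mem hσ with ⟨j, hj⟩ | ⟨j, hj⟩
    · exact notMem_cwVertices (edgeMap_mem_openCell j ht) (by rw [← hj]; exact hx)
    · refine notMem_cwVertices (edgeMap_mem_openCell j (symm_mem_openInterval.2 ht)) ?_
      rw [← hj]
      simpa using hx

theorem cwVertices_nonempty [Nonempty X]
    (hdim : ∀ n : ℕ, 2 ≤ n → IsEmpty (RelCWComplex.cell (Set.univ : Set X) n)) :
    (cwVertices X).Nonempty := by
  obtain ⟨x⟩ := ‹Nonempty X›
  rcases mem_vertices_or_edge hdim x with h | ⟨j, -, -⟩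
  · exact ⟨x, h⟩
  · exact ⟨_, edgeMap_mem_cwVertices j (t := 0) fun h => lt_irrefl _ h.1⟩

/-- The value is invariant under covering transformations, so each 1-cell contributes at most one
value per direction. -/
theorem finite_edge_values [CWComplex.Finite (univ : Set X)] [LocallyPathConnectedSpace X]
    (hp : IsUniversalCovering p) {θ : E → deckGroup p}
    (hθ : ∀ (γ : deckGroup p) x, θ (γ.1 x) = γ * θ x) :
    {g | ∃ σ ∈ edgeLifts p, g = (θ (σ 0))⁻¹ * θ (σ 1)}.Finite := by
  have hfin : Finite (Σ n, cell (univ : Set X) n) := RelCWComplex.finite_cells_of_finite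
  have hfin1 : Finite (cell (univ : Set X) 1) :=
    Finite.of_injective (fun i => (⟨1, i⟩ : Σ n, cell (univ : Set X) n)) fun a b h => by simpa using h
  have key : ∀ σ τ : C(unitInterval, E), p.comp σ = p.comp τ →
      (θ (σ 0))⁻¹ * θ (σ 1) = (θ (τ 0))⁻¹ * θ (τ 1) := by
    intro σ τ h
    obtain ⟨γ, hγ⟩ := exists_deck hp (show p (σ 0) = p (τ 0) from DFunLike.congr_fun h 0)
    have : (γ.1 : C(E, E)).comp σ = τ := by
      refine lift_unique hp.isCoveringMap ?_ (t := 0) hγ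
      rw [← h]
      ext t
      exact γ.2 (σ t)
    have h1 : ∀ t, τ t = γ.1 (σ t) := fun t => by rw [← this]; rfl
    rw [h1, h1, hθ, hθ]
    group
  have hsub : ∀ c : C(unitInterval, X),
      {g | ∃ σ : C(unitInterval, E), p.comp σ = c ∧ g = (θ (σ 0))⁻¹ * θ (σ 1)}.Subsingleton := by
    rintro c _ ⟨σ, hσ, rfl⟩ _ ⟨τ, hτ, rfl⟩
    exact key σ τ (hσ.trans hτ.symm)
  refine (Set.finite_iUnion fun j : cell (univ : Set X) 1 =>
    (hsub (edgeMap j)).finite.union (hsub (revEdge (edgeMap j))).finite).subset ?_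
  rintro g ⟨σ, ⟨j, h | h⟩, rfl⟩
  · exact mem_iUnion.2 ⟨j, Or.inl ⟨σ, h, rfl⟩⟩
  · exact mem_iUnion.2 ⟨j, Or.inr ⟨σ, h, rfl⟩⟩

theorem finite_fiber [CWComplex.Finite (univ : Set X)]
    (hdim : ∀ n : ℕ, 2 ≤ n → IsEmpty (RelCWComplex.cell (Set.univ : Set X) n))
    (hp : IsCoveringMap p) {G : Type*} {θ : E → G}
    (hθ : ∀ x y, p x = p y → θ x = θ y → x = y) {S : Set G} (hS : S.Finite) :
    {x | x ∈ vertexSet (edgeLifts p) ∧ θ x ∈ S}.Finite := by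
  have hfin : Finite (Σ n, cell (univ : Set X) n) := RelCWComplex.finite_cells_of_finite
  have hfin0 : Finite (cell (univ : Set X) 0) :=
    Finite.of_injective (fun i => (⟨0, i⟩ : Σ n, cell (univ : Set X) n)) fun a b h => by simpa using h
  refine Set.Finite.of_finite_image (f := fun x => (p x, θ x))
    (((finite_range fun i : cell (univ : Set X) 0 => map 0 i 0).prod hS).subset ?_) ?_
  · rintro _ ⟨x, ⟨hx, hxS⟩, rfl⟩
    exact ⟨(mem_vertexSet_edgeLifts hdim hp).1 hx, hxS⟩
  · intro x _ y _ h
    exact hθ x y (congrArg Prod.fst h) (congrArg Prod.snd h)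

end Graph

/-! ### Flow lines and attracting fixed words -/

section Attracting

variable {E : Type v} [TopologicalSpace E]

theorem map_mem_vertexSet {𝓔 : Set C(unitInterval, E)} {γ : E ≃ₜ E}
    (hγ : ∀ σ : C(unitInterval, E), (γ : C(E, E)).comp σ ∈ 𝓔 ↔ σ ∈ 𝓔) {x : E} :
    γ x ∈ vertexSet 𝓔 ↔ x ∈ vertexSet 𝓔 := by
  constructor
  · intro h σ hσ t ht he
    exact h _ ((hγ σ).2 hσ) t ht (congrArg γ he)
  · intro h σ hσ t ht he
    have hσ' : (γ : C(E, E)).comp ((γ.symm : C(E, E)).comp σ) = σ := by ext; simp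
    exact h _ ((hγ _).1 (hσ'.symm ▸ hσ)) t ht (γ.symm_apply_eq.2 he)

/-- Were `y` periodic, `s y` would lie behind a later vertex of its own orbit, namely `y`. -/
theorem IsFlow.iterate_ne {𝓔 : Set C(unitInterval, E)} {F : C(E, E)}
    {s : vertexSet 𝓔 → vertexSet 𝓔} {D : vertexSet 𝓔 → Set E} (hs : IsFlow 𝓔 F s D) (n : ℕ)
    (y : vertexSet 𝓔) : s^[n + 1] y ≠ y := by
  intro h
  have h1 := hs.mem_iterate n (s y)
  rw [← Function.iterate_succ_apply, h] at h1
  exact hs.succ_notMem y h1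

theorem exists_isCompact_isPreconnected [PathConnectedSpace E] {S : Set E} (hS : S.Finite) (x : E) :
    ∃ Q, IsCompact Q ∧ IsPreconnected Q ∧ S ⊆ Q ∧ x ∈ Q := by
  let r : E → Set E := fun y => range (PathConnectedSpace.somePath x y)
  have hx : ∀ y, x ∈ r y := fun y => ⟨0, (PathConnectedSpace.somePath x y).source⟩
  have hy : ∀ y, y ∈ r y := fun y => ⟨1, (PathConnectedSpace.somePath x y).target⟩
  refine ⟨⋃ y ∈ insert x S, r y, ?_, ?_, ?_, ?_⟩
  · exact (hS.insert x).isCompact_biUnion fun y _ =>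
      isCompact_range (PathConnectedSpace.somePath x y).continuous
  · rw [← sUnion_image]
    refine isPreconnected_sUnion x _ ?_ ?_
    · rintro _ ⟨y, -, rfl⟩
      exact hx y
    · rintro _ ⟨y, -, rfl⟩
      exact isPreconnected_range (PathConnectedSpace.somePath x y).continuous
  · exact fun y hyS => mem_biUnion (mem_insert_of_mem x hyS) (hy y)
  · exact mem_biUnion (mem_insert x S) (hy x)

theorem IsEdgeSystem.finite_inter_vertexSet {𝓔 : Set C(unitInterval, E)} (h𝓔 : IsEdgeSystem 𝓔)
    {Q : Set E} (hQ : IsCompact Q) : (Q ∩ vertexSet 𝓔).Finite := by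
  refine (hQ.inter_right (h𝓔.isClosed_of_subset_vertexSet Subset.rfl)).finite ?_
  refine ⟨discreteTopology_iff_forall_isClosed.2 fun A => ?_⟩
  have := h𝓔.isClosed_of_subset_vertexSet (A := Subtype.val '' A)
    (by rintro _ ⟨x, -, rfl⟩; exact x.2.2)
  rw [← preimage_image_eq A Subtype.val_injective]
  exact this.preimage continuous_subtype_val

theorem exists_bound {α : Type*} {S : Set α} (hS : S.Finite) (f : α → ℕ) :
    ∃ D, ∀ x ∈ S, f x ≤ D := by
  obtain ⟨D, hD⟩ := (hS.image f).bddAbove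
  exact ⟨D, fun x hx => hD ⟨x, hx, rfl⟩⟩

variable {ι : Type*} [DecidableEq ι]

/-- A selfmap `F` with a flow on a graph `E`, equivariant up to an endomorphism `φ` for a free
action of a free group, together with an equivariant map to the group that changes by a bounded
amount along the edges. -/
structure IsEquivariantFlow (𝓔 : Set C(unitInterval, E)) (F : C(E, E))
    (s : vertexSet 𝓔 → vertexSet 𝓔) (D : vertexSet 𝓔 → Set E) (φ : FreeGroup ι →* FreeGroup ι)
    (ρ : FreeGroup ι →* (E ≃ₜ E)) (θ : E → FreeGroup ι) (C : ℕ) : Prop where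
  edges : IsEdgeSystem 𝓔
  flow : IsFlow 𝓔 F s D
  comp_mem : ∀ g (σ : C(unitInterval, E)), (ρ g : C(E, E)).comp σ ∈ 𝓔 ↔ σ ∈ 𝓔
  free : ∀ g x, ρ g x = x → g = 1
  map_smul : ∀ g x, F (ρ g x) = ρ (φ g) (F x)
  equivariant : ∀ g x, θ (ρ g x) = g * θ x
  finite_fiber : ∀ S : Set (FreeGroup ι), S.Finite → {x | x ∈ vertexSet 𝓔 ∧ θ x ∈ S}.Finite
  norm_edge_le : ∀ σ ∈ 𝓔, ((θ (σ 0))⁻¹ * θ (σ 1)).norm ≤ C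

namespace IsEquivariantFlow

variable {𝓔 : Set C(unitInterval, E)} {F : C(E, E)} {s : vertexSet 𝓔 → vertexSet 𝓔}
  {D : vertexSet 𝓔 → Set E} {φ : FreeGroup ι →* FreeGroup ι} {ρ : FreeGroup ι →* (E ≃ₜ E)}
  {θ : E → FreeGroup ι} {C : ℕ} (h : IsEquivariantFlow 𝓔 F s D φ ρ θ C)
include h

theorem map_mem (g : FreeGroup ι) {x : E} : ρ g x ∈ vertexSet 𝓔 ↔ x ∈ vertexSet 𝓔 :=
  map_mem_vertexSet (h.comp_mem g)

theorem norm_succ_le (y : vertexSet 𝓔) : ((θ y)⁻¹ * θ (s y)).norm ≤ C := by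
  obtain ⟨σ, hσ, h0, h1⟩ := h.flow.exists_edge y
  rw [← h0, ← h1]
  exact h.norm_edge_le σ hσ

/-- The flow lines converge to every attracting fixed word. -/
theorem eventually_prefix [Finite ι] [PathConnectedSpace E] {W : InfWord ι}
    (hW : W.IsAttracting φ) (v : vertexSet 𝓔) (k : ℕ) :
    ∃ N, ∀ n ≥ N, W.initial k <+: (θ (s^[n] v)).toWord := by
  have hρ : ∀ (g : FreeGroup ι) x, ρ g (ρ g⁻¹ x) = x := fun g x => by
    rw [map_inv]; exact (ρ g).apply_symm_apply x
  let v₁ : E := ρ (θ v)⁻¹ v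
  have hv₁ : v₁ ∈ vertexSet 𝓔 := (h.map_mem _).2 v.2
  have hθv₁ : θ v₁ = 1 := (h.equivariant _ _).trans (inv_mul_cancel _)
  -- The translate of `B` by `P` consists of the vertices whose label is within `C` of `P`, the only
  -- ones where a flow line can leave the set of labels beginning with `W_i`.
  let B : Set E := {x | x ∈ vertexSet 𝓔 ∧ θ x ∈ {g : FreeGroup ι | g.norm ≤ C}}
  have hB : B.Finite := h.finite_fiber _ (finite_norm_le C)
  obtain ⟨Q₀, hQ₀c, hQ₀p, hQ₀F, hQ₀v⟩ := exists_isCompact_isPreconnected (hB.image F) v₁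
  have hK := h.edges.finite_inter_vertexSet hQ₀c
  -- Once `P⁻¹ * φ P` is longer than `M`, the translate of `Q₀` by `φ P` misses the translate of `B`
  -- by `P`.
  obtain ⟨M, hM⟩ := exists_bound (hB.prod hK) fun z => (θ z.1 * (θ z.2)⁻¹).norm
  obtain ⟨i, ⟨hi, hiM⟩, hki⟩ := ((hW.eventually M).and (eventually_ge_atTop k)).exists
  set P := FreeGroup.mk (W.initial i) with hP
  have hBy : ∀ y : vertexSet 𝓔, (P⁻¹ * θ y).norm ≤ C →
      (y : E) ∉ ρ (φ P) '' Q₀ ∧ F y ∈ ρ (φ P) '' Q₀ := by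
    intro y hy
    have hyB : ρ P⁻¹ y ∈ B := ⟨(h.map_mem _).2 y.2, by
      change (θ _).norm ≤ C
      rwa [h.equivariant]⟩
    constructor
    · rintro ⟨q, hq, hqy⟩
      have hqV : q ∈ vertexSet 𝓔 := (h.map_mem (φ P)).1 (hqy ▸ y.2)
      have h1 := hM (ρ P⁻¹ y, q) ⟨hyB, hq, hqV⟩
      have h2 : φ P * θ q = θ y := by rw [← h.equivariant, hqy]
      simp only [h.equivariant, ← h2] at h1
      rw [← mul_assoc, mul_assoc, mul_inv_cancel, mul_one] at h1
      exact absurd h1 (not_le.2 hiM)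
    · refine ⟨F (ρ P⁻¹ y), hQ₀F ⟨_, hyB, rfl⟩, ?_⟩
      rw [← h.map_smul, hρ]
  let q : vertexSet 𝓔 := ⟨ρ (φ P) v₁, (h.map_mem _).2 hv₁⟩
  -- If the flow line left at a vertex `y`, then `y` would be near `P` with `q` behind it. The
  -- translate of `Q₀` by `φ P` is connected, contains `q` and avoids `y`, so it would lie behind
  -- `y`; but it contains `F y`.
  have hq : ∀ n, W.initial i <+: (θ (s^[n] q)).toWord := by
    intro n
    induction n with
    | zero =>
      change W.initial i <+: (θ (ρ (φ P) v₁)).toWord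
      rwa [h.equivariant, hθv₁, mul_one]
    | succ n ih =>
      by_contra hnot
      rw [Function.iterate_succ_apply'] at hnot
      obtain ⟨h1, h2⟩ := hBy (s^[n] q) ((norm_le_of_prefix ih hnot).trans (h.norm_succ_le _))
      exact h.flow.map_notMem _ (h.flow.subset (s^[n] q) _
        (hQ₀p.image _ (ρ (φ P)).continuous.continuousOn) h1
        ⟨q, ⟨v₁, hQ₀v, rfl⟩, h.flow.mem_iterate n q⟩ h2)
  obtain ⟨a, b, hab⟩ := h.flow.merge v q
  refine ⟨a, fun n hn => (W.initial_prefix hki).trans ?_⟩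
  rw [← Nat.sub_add_cancel hn, Function.iterate_add_apply, hab, ← Function.iterate_add_apply]
  exact hq _

theorem attracting_unique [Finite ι] [PathConnectedSpace E] (v : vertexSet 𝓔) {W W' : InfWord ι}
    (hW : W.IsAttracting φ) (hW' : W'.IsAttracting φ) : W = W' := by
  refine InfWord.eq_of_prefix fun i => ?_
  obtain ⟨N, hN⟩ := h.eventually_prefix hW v i
  obtain ⟨N', hN'⟩ := h.eventually_prefix hW' v i
  exact ⟨_, hN _ (le_max_left N N'), hN' _ (le_max_right N N')⟩

theorem map_iterate {g : FreeGroup ι} (hg : φ g = g) {y y' : vertexSet 𝓔} (hy : ρ g y = y') (n : ℕ) :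
    ρ g (s^[n] y) = s^[n] y' := by
  induction n with
  | zero => exact hy
  | succ n ih =>
    rw [Function.iterate_succ_apply', Function.iterate_succ_apply']
    exact h.flow.equivariant (ρ g) (h.comp_mem g) (fun x => by rw [h.map_smul, hg]) _ _ ih

/-- Such a flow line stays within bounded distance of the powers of `g`, where the displacement `w⁻¹
* φ w` is bounded. It would also converge to `W`, along which the displacement is unbounded. -/
theorem not_isAttracting_of_translation [Finite ι] [PathConnectedSpace E] {g : FreeGroup ι}
    (hg : φ g = g) {y : vertexSet 𝓔} {d : ℕ} (hy : (s^[d + 1] y : E) = ρ g y) {W : InfWord ι} :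
    ¬ W.IsAttracting φ := by
  intro hW
  have hiter : ∀ k r, (s^[(d + 1) * k + r] y : E) = ρ (g ^ k) (s^[r] y) := by
    intro k
    induction k with
    | zero => intro r; simp
    | succ k ih =>
      intro r
      rw [show (d + 1) * (k + 1) + r = (d + 1) * k + (r + (d + 1)) by ring, ih,
        Function.iterate_add_apply, ← h.map_iterate hg hy.symm, pow_succ, map_mul]
      rfl
  obtain ⟨D₁, hD₁⟩ := exists_bound (finite_le_nat d) fun r => (θ (s^[r] y)).norm
  obtain ⟨M, hM⟩ := exists_bound (finite_norm_le (ι := ι) (D₁ + C)) fun w => (w⁻¹ * φ w).norm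
  obtain ⟨i, ⟨-, hiM⟩, hi⟩ :=
    ((hW.eventually M).and (eventually_gt_atTop (θ y).norm)).exists
  set P := FreeGroup.mk (W.initial i) with hP
  classical
  have hex : ∃ N, W.initial i <+: (θ (s^[N] y)).toWord := by
    obtain ⟨N, hN⟩ := h.eventually_prefix hW y i
    exact ⟨N, hN N le_rfl⟩
  -- The first label beginning with `W_i` is not the initial one, since `i` exceeds the norm of `θ
  -- y`. Entering this set of labels forces a distance at most `C` from `P`.
  obtain ⟨N', hN'⟩ : ∃ N', Nat.find hex = N' + 1 := by
    refine Nat.exists_eq_succ_of_ne_zero fun h0 => ?_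
    have h1 := (h0 ▸ Nat.find_spec hex : W.initial i <+: (θ (s^[0] y)).toWord).length_le
    rw [W.length_initial] at h1
    exact absurd h1 (not_le.2 hi)
  have h1 : W.initial i <+: (θ (s^[N' + 1] y)).toWord := hN' ▸ Nat.find_spec hex
  have h2 : ¬ W.initial i <+: (θ (s^[N'] y)).toWord := Nat.find_min hex (by omega)
  have h3 : (P⁻¹ * θ (s^[N' + 1] y)).norm ≤ C := by
    refine (norm_le_of_prefix h1 h2).trans ?_
    rw [← FreeGroup.norm_inv_eq, mul_inv_rev, inv_inv, Function.iterate_succ_apply']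
    exact h.norm_succ_le _
  set k := (N' + 1) / (d + 1)
  set r := (N' + 1) % (d + 1)
  have hr : r ≤ d := Nat.lt_succ_iff.1 (Nat.mod_lt _ d.succ_pos)
  rw [← Nat.div_add_mod (N' + 1) (d + 1), hiter, h.equivariant] at h3
  -- Removing the full periods leaves `P` at distance at most `D₁ + C` from `g ^ k`.
  have h4 := hM ((g ^ k)⁻¹ * P) (by
    have h5 : (g ^ k)⁻¹ * P = θ (s^[r] y) * (P⁻¹ * (g ^ k * θ (s^[r] y)))⁻¹ := by group
    change FreeGroup.norm _ ≤ _
    rw [h5]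
    refine (FreeGroup.norm_mul_le _ _).trans (add_le_add (hD₁ r hr) ?_)
    rw [FreeGroup.norm_inv_eq]
    exact h3)
  have h6 : ((g ^ k)⁻¹ * P)⁻¹ * φ ((g ^ k)⁻¹ * P) = P⁻¹ * φ P := by
    rw [map_mul, map_inv, map_pow, hg]; group
  rw [h6] at h4
  exact absurd h4 (not_le.2 hiM)

/-- The flow lines of `v` and of its translate merge. After unequal numbers of steps, `g` or its
inverse would translate a flow line along itself; after equal numbers, `g` fixes a vertex. -/
theorem eq_one_of_isAttracting [Finite ι] [PathConnectedSpace E] (v : vertexSet 𝓔)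
    {g : FreeGroup ι} (hg : φ g = g) {W : InfWord ι} (hW : W.IsAttracting φ) : g = 1 := by
  obtain ⟨m, n, hmn⟩ := h.flow.merge v ⟨ρ g v, (h.map_mem g).2 v.2⟩
  have hmn' : (s^[m] v : E) = ρ g (s^[n] v) := by
    rw [hmn, h.map_iterate hg (y' := ⟨ρ g v, (h.map_mem g).2 v.2⟩) rfl]
  rcases lt_trichotomy m n with hlt | rfl | hlt
  · obtain ⟨d, rfl⟩ := Nat.exists_eq_add_of_lt hlt
    refine (h.not_isAttracting_of_translation (g := g⁻¹) (by rw [map_inv, hg]) (y := s^[m] v)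
      (d := d) ?_ hW).elim
    rw [← Function.iterate_add_apply, hmn', map_inv, show d + 1 + m = m + d + 1 by ring]
    exact ((ρ g).symm_apply_apply _).symm
  · exact h.free g _ hmn'.symm
  · obtain ⟨d, rfl⟩ := Nat.exists_eq_add_of_lt hlt
    refine (h.not_isAttracting_of_translation hg (y := s^[n] v) (d := d) ?_ hW).elim
    rw [← Function.iterate_add_apply, ← hmn', show d + 1 + n = n + d + 1 by ring]

end IsEquivariantFlow

end Attracting

/-! ### The bound for a fixed point free lifting -/

section Graph

variable {X : Type u} [TopologicalSpace X] [T2Space X] [ConnectedSpace X]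
  [CWComplex (univ : Set X)] [CWComplex.Finite (univ : Set X)] {f : C(X, X)}
  {E : Type v} [TopologicalSpace E] {p : C(E, X)}

omit [ConnectedSpace X] [CWComplex.Finite (univ : Set X)] in
theorem isCyclic_fixSubgroup (hp : IsUniversalCovering p) (F : Lifting p f)
    {s : vertexSet (edgeLifts p) → vertexSet (edgeLifts p)} {D : vertexSet (edgeLifts p) → Set E}
    (hs : IsFlow (edgeLifts p) F.toMap s D) (v : vertexSet (edgeLifts p)) :
    IsCyclic (fixSubgroup (F.inducedHom hp)) := by
  have := hp.simplyConnected
  have hmem : ∀ (g : fixSubgroup (F.inducedHom hp)) (y : vertexSet (edgeLifts p)),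
      g.1.1 y ∈ vertexSet (edgeLifts p) := fun g y =>
    (map_mem_vertexSet (comp_mem_edgeLifts g.1)).2 y.2
  let _ : MulAction (fixSubgroup (F.inducedHom hp)) (vertexSet (edgeLifts p)) :=
    { smul := fun g y => ⟨g.1.1 y, hmem g y⟩
      one_smul := fun _ => rfl
      mul_smul := fun _ _ _ => rfl }
  refine isCyclic_of_acyclic (s := s) (fun g y hy => ?_) (fun g y => ?_) (fun n y => hs.iterate_ne n y)
    hs.merge v
  · exact Subtype.ext (deck_eq_one hp.isCoveringMap g.1 (congrArg Subtype.val hy))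
  · refine Subtype.ext (hs.equivariant g.1.1 (comp_mem_edgeLifts g.1) (fun x => ?_) _ _ rfl).symm
    rw [F.inducedHom_spec hp, show F.inducedHom hp g.1 = g.1 from g.2]

theorem exists_isEquivariantFlow
    (hdim : ∀ n : ℕ, 2 ≤ n → IsEmpty (RelCWComplex.cell (Set.univ : Set X) n))
    (hp : IsUniversalCovering p) (F : Lifting p f)
    {s : vertexSet (edgeLifts p) → vertexSet (edgeLifts p)} {D : vertexSet (edgeLifts p) → Set E}
    (hs : IsFlow (edgeLifts p) F.toMap s D) {ι : Type*} [DecidableEq ι] [Finite ι]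
    (b : FreeGroupBasis ι (deckGroup p)) :
    ∃ ρ θ C, IsEquivariantFlow (edgeLifts p) F.toMap s D
      ((b.repr.toMonoidHom.comp (F.inducedHom hp)).comp b.repr.symm.toMonoidHom) ρ θ C := by
  have := hp.simplyConnected
  obtain ⟨θ, hθ, hθinj⟩ := exists_equivariant hp
  obtain ⟨C, hC⟩ := exists_bound (finite_edge_values hp hθ) fun g => (b.repr g).norm
  refine ⟨(deckGroup p).subtype.comp b.repr.symm.toMonoidHom, fun x => b.repr (θ x), C,
    isEdgeSystem_edgeLifts hdim hp.isCoveringMap, hs, fun g σ => comp_mem_edgeLifts _ σ,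
    fun g x hx => ?_, fun g x => ?_, fun g x => ?_, fun S hS => ?_, fun σ hσ => ?_⟩
  · have := deck_eq_one hp.isCoveringMap (b.repr.symm g) hx
    simpa using this
  · refine (F.inducedHom_spec hp (b.repr.symm g) x).trans ?_
    simp
  · have h1 : θ ((b.repr.symm g).1 x) = b.repr.symm g * θ x := hθ _ _
    change b.repr (θ ((b.repr.symm g).1 x)) = _
    rw [h1, map_mul, MulEquiv.apply_symm_apply]
  · exact finite_fiber hdim hp.isCoveringMap (θ := fun x => b.repr (θ x))
      (fun x y hxy h => hθinj x y hxy (b.repr.injective h)) hS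
  · rw [← map_inv, ← map_mul]
    exact hC _ ⟨σ, hσ, rfl⟩

/-- The rank and the number of attracting classes of a fixed point free lifting. -/
theorem rk_add_a_le_one
    (hdim : ∀ n : ℕ, 2 ≤ n → IsEmpty (RelCWComplex.cell (Set.univ : Set X) n))
    (hp : IsUniversalCovering p) (F : Lifting p f) (hF : ∀ x, F.toMap x ≠ x) :
    F.rk hp + F.a hp ≤ 1 := by
  have := hp.simplyConnected
  have := locallyPathConnectedSpace_of_covering hp.isCoveringMap
  obtain ⟨s, D, hs⟩ := (isEdgeSystem_edgeLifts hdim hp.isCoveringMap).exists_isFlow hF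
  obtain ⟨x, hx⟩ := cwVertices_nonempty (X := X) hdim
  obtain ⟨v, rfl⟩ := hp.surjective x
  have hv : v ∈ vertexSet (edgeLifts p) := (mem_vertexSet_edgeLifts hdim hp.isCoveringMap).2 hx
  have hcyc := isCyclic_fixSubgroup hp F hs ⟨v, hv⟩
  have hrk : F.rk hp ≤ 1 := groupRank_le_one _
  rw [Lifting.a, attractingNumber]
  split_ifs with hb
  · set b : FreeGroupBasis (Fin hb.choose) (deckGroup p) := hb.choose_spec.some
    obtain ⟨ρ, θ, C, hflow⟩ := exists_isEquivariantFlow hdim hp F hs b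
    set φ := (b.repr.toMonoidHom.comp (F.inducedHom hp)).comp b.repr.symm.toMonoidHom with hφ
    change F.rk hp + (attractingClasses φ).encard ≤ 1
    -- A single attracting word forces the fixed subgroup to be trivial and is the only such word.
    rcases (attractingClasses φ).eq_empty_or_nonempty with h0 | ⟨-, W, hW, -⟩
    · rw [h0, encard_empty, add_zero]
      exact hrk
    · have ha : (attractingClasses φ).encard ≤ 1 := by
        rw [encard_le_one_iff]
        rintro _ _ ⟨W₁, hW₁, rfl⟩ ⟨W₂, hW₂, rfl⟩
        rw [hflow.attracting_unique ⟨v, hv⟩ hW₁ hW₂]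
      have : Subsingleton (fixSubgroup (F.inducedHom hp)) := by
        refine ⟨fun g k => ?_⟩
        have key : ∀ g : fixSubgroup (F.inducedHom hp), g.1 = 1 := by
          intro g
          have hg : F.inducedHom hp g.1 = g.1 := g.2
          have := hflow.eq_one_of_isAttracting ⟨v, hv⟩ (g := b.repr g.1) (by simp [hφ, hg]) hW
          simpa using this
        exact Subtype.ext ((key g).trans (key k).symm)
      have hrk0 : F.rk hp = 0 := groupRank_eq_zero _
      rw [hrk0, zero_add]
      exact ha
  -- Without a finite basis the number of classes is 0 by convention, and the rank bound suffices.
  · rw [add_zero]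
    exact hrk

omit [ConnectedSpace X] [CWComplex.Finite (univ : Set X)] in
theorem ichr_mem_of_rk_add_a_le_one (hp : IsUniversalCovering p) (F : Lifting p f)
    (h : F.rk hp + F.a hp ≤ 1) : 0 ≤ F.ichr hp ∧ F.ichr hp ≤ 1 := by
  have h1 : F.rk hp ≤ 1 := le_self_add.trans h
  have h2 : F.a hp ≤ 1 := le_add_self.trans h
  have hcases : ∀ n : ℕ∞, n ≤ 1 → n = 0 ∨ n = 1 := fun n hn => by
    rcases hn.lt_or_eq with hn | hn
    · exact Or.inl (Order.lt_one_iff.1 hn)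
    · exact Or.inr hn
  rw [Lifting.ichr]
  have h11 : (1 : EReal) - 1 = 0 := EReal.sub_self (EReal.coe_ne_top 1) (EReal.coe_ne_bot 1)
  rcases hcases _ h1 with hr | hr <;> rcases hcases _ h2 with ha | ha
  · simp [hr, ha]
  · simp [hr, ha, h11]
  · simp [hr, ha, h11]
  · rw [hr, ha] at h
    exact absurd h (by decide)

end Graph

end GraphFix

theorem proposition3p1 {X : Type*} [TopologicalSpace X] [T2Space X] [ConnectedSpace X]
    [CWComplex (Set.univ : Set X)] [CWComplex.Finite (Set.univ : Set X)]
    (hdim : ∀ n : ℕ, 2 ≤ n → IsEmpty (RelCWComplex.cell (Set.univ : Set X) n))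
    (f : C(X, X)) (hf : GraphFix.IsPiOneInjective f)
    {E : Type*} [TopologicalSpace E] (p : C(E, X)) (hp : GraphFix.IsUniversalCovering p)
    (F : GraphFix.Lifting p f) :
    (F.fixedPointClass = ∅ → 0 ≤ F.ichr hp ∧ F.ichr hp ≤ 1) ∧
      (1 < F.rk hp + F.a hp → ∃ x : E, F.toMap x = x) := by
  constructor
  · intro hempty
    refine GraphFix.ichr_mem_of_rk_add_a_le_one hp F (GraphFix.rk_add_a_le_one hdim hp F ?_)
    intro x hx
    exact Set.eq_empty_iff_forall_notMem.1 hempty (p x) ⟨x, hx, rfl⟩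
  · intro hlt
    by_contra! hF
    exact not_le.2 hlt (GraphFix.rk_add_a_le_one hdim hp F hF)
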